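/- \textbf{Corollary (phantom depth is unaffected by completion).} Let $p>0$ be a prime number, let $(R,\mathfrak m)$ be a Noetherian local ring of characteristic $p$ with $\mathfrak m$-adic completion $\hat R$, and let $M$ be a finitely generated $R$-module with $\mathfrak m$-adic completion $\hat M$. Suppose that $R$ has a completely stable weak test element and that $M$ satisfies avoidance. Then $$\operatorname{pdepth}_R M = \operatorname{pdepth}_{\hat R}\hat M .$$ The notions used, for a Noetherian ring $A$ of characteristic $p$ and a finitely generated $A$-module $L$, are as follows. \emph{Frobenius powers.} $F^e(L)=F^e_A(L)$ is the base change of $L$ along the $e$-th iterate $a\mapsto a^{p^e}$ of the Frobenius endomorphism of $A$; $z^{p^e}$ denotes the element $1\otimes z$ of $F^e(L)$ for $z\in L$; and for a submodule $N\subseteq L$, $N^{[p^e]}_L$ is the image of $F^e(N)\to F^e(L)$. \emph{Tight closure.} Let $A^o$ be the complement of the union of the minimal primes of $A$. An element $z\in L$ is in the tight closure $N^*_L$ of a submodule $N\subseteq L$ if there are $c\in A^o$ and $e_0\ge 0$ with $c\,z^{p^e}\in N^{[p^e]}_L$ for all $e\ge e_0$. Put $G^e(L)=F^e(L)/0^*_{F^e(L)}$.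 \emph{Weak test elements.} Let $q_0=p^{e_0}$ be a power of $p$. An element $c\in A^o$ is a $q_0$-weak test element for $A$ if $c\,z^{p^e}\in N^{[p^e]}_L$ for all $e\ge e_0$, all finitely generated $A$-modules $L$, all submodules $N\subseteq L$ and all $z\in N^*_L$. A $q_0$-weak test element $c$ for the local ring $R$ is completely stable if its image in $\hat R$ is a $q_0$-weak test element for $\hat R$, and its image in $\hat R_{P}$ is a $q_0$-weak test element for $\hat R_{P}$ for every prime ideal $P$ of $\hat R$ that contains the image of $c$. \emph{Avoidance.} $M$ satisfies avoidance if for every quotient module $N$ of $M$ and every ideal $I\subseteq R$ with $I\subseteq\bigcup_{e\ge 0}\bigcup_{P\in\operatorname{Ass} G^e(N)}P$ there are $e\ge 0$ and $P\in\operatorname{Ass}G^e(N)$ with $I\subseteq P$. \emph{Phantom depth.} An element $x\in A$ is phantom $L$-regular if $xL\ne L$ and, for all $e\ge 0$, every $u\in F^e(L)$ with $x^{p^e}u=0$ lies in $0^*_{F^e(L)}$. A finite, possibly empty, sequence $x_1,\dots,x_n\in A$ is a phantom $L$-regular sequence if $(x_1,\dots,x_n)L\ne L$ and $x_i$ is phantom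 $L/(x_1,\dots,x_{i-1})L$-regular for $1\le i\le n$. If $A$ is local, $\operatorname{pdepth}_A L\in\{0,1,2,\dots,\infty\}$ is the supremum of the lengths of the phantom $L$-regular sequences in the maximal ideal of $A$ (and is $0$ if $L=0$). -/

import Mathlib

open scoped TensorProduct

universe u

section Characteristic

/-- A nontrivial algebra over a ring of prime characteristic `p` has characteristic `p`. -/
theorem charP_of_nontrivial_algebra (R A : Type*) [CommRing R] [CommRing A] [Algebra R A]
    [Nontrivial A] (p : ℕ) [Fact p.Prime] [CharP R p] : CharP A p := by
  have h0 : (p : A) = 0 := by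
    rw [← map_natCast (algebraMap R A), CharP.cast_eq_zero, map_zero]
  obtain ⟨n, hn⟩ := CharP.exists A
  have hdvd : n ∣ p := (CharP.cast_eq_zero_iff A n p).1 h0
  rcases (Nat.dvd_prime (Fact.out : p.Prime)).1 hdvd with h1 | h1
  · subst h1
    exact (CharP.false_of_nontrivial_of_char_one (R := A)).elim
  · exact h1 ▸ hn

instance charP_completion (R : Type u) [CommRing R] [IsNoetherianRing R] [IsLocalRing R]
    (p : ℕ) [Fact p.Prime] [CharP R p] :
    CharP (AdicCompletion (IsLocalRing.maximalIdeal R) R) p :=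
  charP_of_nontrivial_algebra R _ p

instance charP_localizationAtPrime (R : Type u) [CommRing R] (P : Ideal R) [P.IsPrime]
    (p : ℕ) [Fact p.Prime] [CharP R p] : CharP (Localization.AtPrime P) p :=
  charP_of_nontrivial_algebra R _ p

end Characteristic

section Frobenius

/-- The ring `R`, to be viewed as an `R`-algebra through the `e`-th iterate
`r ↦ r ^ p ^ e` of the Frobenius endomorphism. -/
def FrobeniusTwist (R : Type u) (_p _e : ℕ) : Type u := R

variable (R : Type u) [CommRing R] (p : ℕ) [Fact p.Prime] [CharP R p] (e : ℕ)

instance : CommRing (FrobeniusTwist R p e) := inferInstanceAs (CommRing R)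

/-- The `R`-algebra structure through the `e`-th iterate of Frobenius. -/
noncomputable instance : Algebra R (FrobeniusTwist R p e) :=
  RingHom.toAlgebra (S := FrobeniusTwist R p e) (iterateFrobenius R p e)

/-- The identity map from `R` to its Frobenius twist, a ring homomorphism. -/
def FrobeniusTwist.of : R →+* FrobeniusTwist R p e := RingHom.id R

variable (M : Type u) [AddCommGroup M] [Module R M]

/-- The Frobenius power `F^e(M)`: the base change of `M` along the `e`-th iterate of Frobenius. -/
def FrobeniusPower : Type u := FrobeniusTwist R p e ⊗[R] M

noncomputable instance : AddCommGroup (FrobeniusPower R p e M) :=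
  inferInstanceAs (AddCommGroup (FrobeniusTwist R p e ⊗[R] M))

/-- `R` acts on `F^e(M)` through the left factor, so that `r • (s ⊗ z) = (r * s) ⊗ z`. -/
noncomputable instance : Module R (FrobeniusPower R p e M) :=
  Module.compHom (FrobeniusTwist R p e ⊗[R] M) (FrobeniusTwist.of R p e)

variable {M}

/-- The element `z ^ (p ^ e)` of `F^e(M)` attached to `z ∈ M`. -/
noncomputable def frobeniusElement (z : M) : FrobeniusPower R p e M :=
  (1 : FrobeniusTwist R p e) ⊗ₜ[R] z

theorem frobeniusElement_add (z w : M) :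
    frobeniusElement R p e (z + w) = frobeniusElement R p e z + frobeniusElement R p e w :=
  TensorProduct.tmul_add _ _ _

theorem frobeniusElement_zero : frobeniusElement R p e (0 : M) = 0 :=
  TensorProduct.tmul_zero _ _

theorem frobeniusElement_smul (r : R) (z : M) :
    frobeniusElement R p e (r • z) = r ^ p ^ e • frobeniusElement R p e z := by
  have h : (1 : FrobeniusTwist R p e) ⊗ₜ[R] (r • z)
      = (FrobeniusTwist.of R p e (r ^ p ^ e)) • ((1 : FrobeniusTwist R p e) ⊗ₜ[R] z) := by
    rw [← TensorProduct.smul_tmul, TensorProduct.smul_tmul', Algebra.smul_def, smul_eq_mul]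
    rfl
  exact h

variable {R} {N : Type u} [AddCommGroup N] [Module R N]

/-- The map `F^e(f) : F^e(M) → F^e(N)` induced by an `R`-linear map `f`. -/
noncomputable def FrobeniusPower.map (f : M →ₗ[R] N) :
    FrobeniusPower R p e M →ₗ[R] FrobeniusPower R p e N where
  toFun := f.baseChange (FrobeniusTwist R p e)
  map_add' := fun x y => map_add (f.baseChange (FrobeniusTwist R p e)) x y
  map_smul' := fun r x =>
    (f.baseChange (FrobeniusTwist R p e)).map_smul' (FrobeniusTwist.of R p e r) x

/-- `N^{[p^e]}_M`: the image of `F^e(N)` in `F^e(M)`, for a submodule `N` of `M`. -/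
noncomputable def Submodule.frobeniusPower (N : Submodule R M) :
    Submodule R (FrobeniusPower R p e M) :=
  LinearMap.range (FrobeniusPower.map p e N.subtype)

end Frobenius

section TightClosure

/-- `R^o`: the complement of the union of the minimal primes of `R`. -/
def complMinimalPrimes (R : Type u) [CommRing R] : Submonoid R where
  carrier := {c | ∀ P ∈ minimalPrimes R, c ∉ P}
  one_mem' := fun P hP h => (show P.IsPrime from hP.1.1).ne_top ((Ideal.eq_top_iff_one P).2 h)
  mul_mem' := fun ha hb P hP h =>
    ((show P.IsPrime from hP.1.1).mem_or_mem h).elim (ha P hP) (hb P hP)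

variable {R : Type u} [CommRing R] (p : ℕ) [Fact p.Prime] [CharP R p]
  {M : Type u} [AddCommGroup M] [Module R M]

/-- The tight closure `N^*_M` of a submodule `N` of `M`. -/
noncomputable def Submodule.tightClosure (N : Submodule R M) : Submodule R M where
  carrier := {z | ∃ c ∈ complMinimalPrimes R, ∃ e₀ : ℕ, ∀ e ≥ e₀,
    c • frobeniusElement R p e z ∈ N.frobeniusPower p e}
  zero_mem' := ⟨1, one_mem _, 0, fun e _ => by
    rw [frobeniusElement_zero, smul_zero]; exact zero_mem _⟩
  add_mem' := by
    rintro z w ⟨c, hc, e₁, h₁⟩ ⟨d, hd, e₂, h₂⟩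
    refine ⟨c * d, mul_mem hc hd, max e₁ e₂, fun e he => ?_⟩
    rw [frobeniusElement_add, smul_add]
    refine add_mem ?_ ?_
    · rw [mul_comm, mul_smul]
      exact Submodule.smul_mem _ _ (h₁ e (le_trans (le_max_left _ _) he))
    · rw [mul_smul]
      exact Submodule.smul_mem _ _ (h₂ e (le_trans (le_max_right _ _) he))
  smul_mem' := by
    rintro r z ⟨c, hc, e₀, h⟩
    refine ⟨c, hc, e₀, fun e he => ?_⟩
    rw [frobeniusElement_smul, smul_comm]
    exact Submodule.smul_mem _ _ (h e he)

variable (R) in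
/-- `c` is a `p ^ e₀`-weak test element for `R`. -/
def IsWeakTestElement (e₀ : ℕ) (c : R) : Prop :=
  c ∈ complMinimalPrimes R ∧
    ∀ (M : Type u) [AddCommGroup M] [Module R M] [Module.Finite R M] (N : Submodule R M),
      ∀ z ∈ N.tightClosure p, ∀ e ≥ e₀, c • frobeniusElement R p e z ∈ N.frobeniusPower p e

variable (R) in
/-- `c` is a completely stable `p ^ e₀`-weak test element for the Noetherian local ring `R`:
it is a `p ^ e₀`-weak test element for `R`, its image in the completion of `R` is one for the
completion, and its image in the localization of the completion at any prime ideal containing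
the image of `c` is one for that localization. (If `c` is not a unit, the condition on the
completion is the condition on localizations at the maximal ideal of the completion; if `c` is
a unit, no prime contains its image, so that the condition has to be stated separately.) -/
def IsCompletelyStableWeakTestElement [IsNoetherianRing R] [IsLocalRing R]
    (e₀ : ℕ) (c : R) : Prop :=
  IsWeakTestElement R p e₀ c ∧
  IsWeakTestElement (AdicCompletion (IsLocalRing.maximalIdeal R) R) p e₀
    (algebraMap R (AdicCompletion (IsLocalRing.maximalIdeal R) R) c) ∧
  ∀ (P : Ideal (AdicCompletion (IsLocalRing.maximalIdeal R) R)) [P.IsPrime],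
    algebraMap R (AdicCompletion (IsLocalRing.maximalIdeal R) R) c ∈ P →
    IsWeakTestElement (Localization.AtPrime P) p e₀
      (algebraMap (AdicCompletion (IsLocalRing.maximalIdeal R) R) (Localization.AtPrime P)
        (algebraMap R (AdicCompletion (IsLocalRing.maximalIdeal R) R) c))

end TightClosure

section PhantomDepth

variable (R : Type u) [CommRing R] (p : ℕ) [Fact p.Prime] [CharP R p]
  (M : Type u) [AddCommGroup M] [Module R M]

/-- The reduced Frobenius power `G^e(M) = F^e(M) / 0^*_{F^e(M)}`. -/
abbrev ReducedFrobeniusPower (e : ℕ) : Type u :=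
  FrobeniusPower R p e M ⧸ (⊥ : Submodule R (FrobeniusPower R p e M)).tightClosure p

/-- `M` satisfies avoidance: for every quotient `N` of `M`, any ideal contained in the union of
all associated primes of all `G^e(N)` is contained in one of these primes. -/
def SatisfiesAvoidance : Prop :=
  ∀ (K : Submodule R M) (I : Ideal R),
    (I : Set R) ⊆ ⋃ e : ℕ, ⋃ P ∈ associatedPrimes R (ReducedFrobeniusPower R p (M ⧸ K) e),
      (P : Set R) →
    ∃ e : ℕ, ∃ P ∈ associatedPrimes R (ReducedFrobeniusPower R p (M ⧸ K) e), I ≤ P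

variable {R}

/-- `x` is phantom `M`-regular. -/
def IsPhantomRegular (x : R) : Prop :=
  Ideal.span {x} • (⊤ : Submodule R M) ≠ ⊤ ∧
    ∀ (e : ℕ) (u : FrobeniusPower R p e M), x ^ p ^ e • u = 0 →
      u ∈ (⊥ : Submodule R (FrobeniusPower R p e M)).tightClosure p

/-- `x₁, …, xₙ` is a phantom `M`-regular sequence. -/
def IsPhantomRegularSequence (xs : List R) : Prop :=
  Ideal.ofList xs • (⊤ : Submodule R M) ≠ ⊤ ∧
    ∀ (i : ℕ) (hi : i < xs.length),
      IsPhantomRegular p (M ⧸ (Ideal.ofList (xs.take i) • ⊤ : Submodule R M)) xs[i]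

variable (R)

/-- The phantom depth of `M`: the supremum of the lengths of the phantom `M`-regular sequences
in the maximal ideal. (For `M = 0` there are no such sequences, and the value is `0`.) -/
noncomputable def phantomDepth [IsLocalRing R] : ℕ∞ :=
  ⨆ (xs : List R) (_ : ∀ x ∈ xs, x ∈ IsLocalRing.maximalIdeal R)
    (_ : IsPhantomRegularSequence p M xs), (xs.length : ℕ∞)

end PhantomDepth

/-!
Write `S` for the completion of `R`. Since `c` is a weak test element for both rings, an element
`u ∈ F^e(M)` is in the tight closure of zero exactly if `c u ^ p ^ k = 0` for all `k ≥ e₀`, and this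
condition passes to and from the faithfully flat extension `S`, since
`F^e_S(S ⊗ M) = S ⊗ F^e_R(M)`.
All quotients `M / IM` are handled inside the modules `F^e(M)`, via the tight closure of
`I^{[p^e]} F^e(M)` (`Ideal.frobeniusTightClosure`), and regularity is expressed by
`IsPhantomNonzerodivisor`.

By flatness, phantom regular sequences over `R` remain phantom regular over `S`
(`HasPhantomSequence.map_algebraMap`), so the depth cannot drop.

Conversely let a phantom regular sequence of length `n` over `S` be given. Its first member shows
that the maximal ideal of `R` annihilates no nonzero element of any `G^e(M)`; hence, by avoidance,
`R` itself contains a phantom regular element `x`. By induction it suffices to find a sequence of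
length `n - 1` over `S` for the completion of `M / xM`. This is the
exchange property `HasPhantomSequence.exchange`:
given a sequence `y, w, …` and a phantom regular element `x`, one chooses `z` phantom regular modulo
both `x` and `y`; then `x` and `y` are phantom regular modulo `z`
(`IsPhantomNonzerodivisor.swap`), and induction leads from `y` to `z` and from `z` to `x`.

Such a `z` exists because the associated primes to be avoided are countably many, the maximal ideal
is not among them (`IsPhantomNonzerodivisor.mem_of_smul_mem_of_smul_mem`), and countable prime
avoidance holds in a complete Noetherian local ring
(`IsLocalRing.exists_mem_maximalIdeal_forall_notMem`).
-/

/-! ### Frobenius powers and Frobenius maps -/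

section FrobeniusPower

variable {R : Type u} [CommRing R] (p : ℕ) [Fact p.Prime] [CharP R p]
  {M : Type u} [AddCommGroup M] [Module R M]

/-- The identity map from the Frobenius twist of `R` to `R`, a ring homomorphism. -/
def FrobeniusTwist.out (R : Type u) [CommRing R] (p e : ℕ) : FrobeniusTwist R p e →+* R :=
  RingHom.id R

theorem FrobeniusPower.induction_tmul {e : ℕ} {C : FrobeniusPower R p e M → Prop}
    (u : FrobeniusPower R p e M)
    (tmul : ∀ (r : R) (z : M), C (FrobeniusTwist.of R p e r ⊗ₜ[R] z : FrobeniusTwist R p e ⊗[R] M))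
    (zero : C 0) (add : ∀ u v, C u → C v → C (u + v)) : C u :=
  TensorProduct.induction_on (M := FrobeniusTwist R p e) (motive := C) u zero tmul add

/-- The elements `z ^ p ^ e` generate `F^e(M)`. -/
theorem span_range_frobeniusElement (e : ℕ) :
    Submodule.span R (Set.range (frobeniusElement R p e : M → FrobeniusPower R p e M)) = ⊤ := by
  refine Submodule.eq_top_iff'.2 fun u => ?_
  induction u using TensorProduct.induction_on with
  | zero => exact zero_mem _
  | add x y hx hy => exact add_mem hx hy
  | tmul s z =>
    have h : (s ⊗ₜ z : FrobeniusTwist R p e ⊗[R] M)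
        = (FrobeniusTwist.of R p e s) • ((1 : FrobeniusTwist R p e) ⊗ₜ[R] z) := by
      rw [TensorProduct.smul_tmul', smul_eq_mul, mul_one]
      rfl
    rw [h]
    exact Submodule.smul_mem _ (s : R) (Submodule.subset_span ⟨z, rfl⟩)

theorem FrobeniusPower.induction {e : ℕ} {C : FrobeniusPower R p e M → Prop}
    (u : FrobeniusPower R p e M) (elem : ∀ z : M, C (frobeniusElement R p e z)) (zero : C 0)
    (add : ∀ u v, C u → C v → C (u + v)) (smul : ∀ (r : R) u, C u → C (r • u)) : C u := by
  have hu : u ∈ Submodule.span R (Set.range (frobeniusElement R p e : M → _)) := by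
    rw [span_range_frobeniusElement]; trivial
  induction hu using Submodule.span_induction with
  | mem x hx => obtain ⟨z, rfl⟩ := hx; exact elem z
  | zero => exact zero
  | add x y _ _ hx hy => exact add x y hx hy
  | smul a x _ hx => exact smul a x hx

instance FrobeniusPower.finite [Module.Finite R M] (e : ℕ) :
    Module.Finite R (FrobeniusPower R p e M) := by
  obtain ⟨s, hs⟩ := (Module.Finite.fg_top : (⊤ : Submodule R M).FG)
  classical
  refine ⟨⟨s.image (frobeniusElement R p e), ?_⟩⟩
  rw [eq_top_iff, ← span_range_frobeniusElement, Submodule.span_le]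
  rintro _ ⟨z, rfl⟩
  have hz : z ∈ Submodule.span R (s : Set M) := by rw [hs]; trivial
  induction hz using Submodule.span_induction with
  | mem x hx => exact Submodule.subset_span (by simpa using ⟨x, hx, rfl⟩)
  | zero => rw [frobeniusElement_zero]; exact zero_mem _
  | add x y _ _ hx hy => rw [frobeniusElement_add]; exact add_mem hx hy
  | smul a x _ hx => rw [frobeniusElement_smul]; exact Submodule.smul_mem _ _ hx

section Lift

variable {S : Type u} [CommRing S] {L : Type u} [AddCommGroup L] [Module S L]

/-- The additive map underlying `FrobeniusPower.lift`. -/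
noncomputable def FrobeniusPower.liftAddHom {e : ℕ} (τ : R →+* S) (g : M →+ L)
    (hg : ∀ (r : R) (z : M), g (r • z) = τ r ^ p ^ e • g z) :
    FrobeniusPower R p e M →+ L :=
  TensorProduct.liftAddHom (M := FrobeniusTwist R p e)
    (AddMonoidHom.mk' (fun s =>
        (DistribSMul.toAddMonoidHom L (τ (FrobeniusTwist.out R p e s))).comp g)
      (fun s t => by
        ext z
        change τ (FrobeniusTwist.out R p e (s + t)) • g z = _
        rw [map_add, map_add, add_smul]
        rfl))
    (fun r s z => by
      change τ (r ^ p ^ e * FrobeniusTwist.out R p e s) • g z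
        = τ (FrobeniusTwist.out R p e s) • g (r • z)
      rw [hg, map_mul, map_pow, mul_comm, mul_smul])

/-- The universal property of `F^e(M)`: an additive map `g` on `M` with
`g (r • z) = τ r ^ p ^ e • g z` extends to the `τ`-semilinear map `r • z ^ p ^ e ↦ τ r • g z`. -/
noncomputable def FrobeniusPower.lift {e : ℕ} (τ : R →+* S) (g : M →+ L)
    (hg : ∀ (r : R) (z : M), g (r • z) = τ r ^ p ^ e • g z) :
    FrobeniusPower R p e M →ₛₗ[τ] L :=
  have hsmul : ∀ (r : R) (u : FrobeniusPower R p e M),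
      FrobeniusPower.liftAddHom p τ g hg (r • u)
        = τ r • FrobeniusPower.liftAddHom p τ g hg u := by
    intro r u
    induction u using FrobeniusPower.induction_tmul with
    | tmul s z =>
      change τ (r * s) • g z = τ r • τ s • g z
      rw [map_mul, mul_smul]
    | zero => simp
    | add x y hx hy => rw [smul_add, map_add, map_add, hx, hy, smul_add]
  { FrobeniusPower.liftAddHom p τ g hg with map_smul' := hsmul }

@[simp] theorem FrobeniusPower.lift_frobeniusElement {e : ℕ} (τ : R →+* S) (g : M →+ L)
    (hg : ∀ (r : R) (z : M), g (r • z) = τ r ^ p ^ e • g z) (z : M) :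
    FrobeniusPower.lift p τ g hg (frobeniusElement R p e z) = g z := by
  change τ (1 : R) • g z = g z
  rw [map_one, one_smul]

end Lift

variable (R) in
/-- `z ↦ z ^ p ^ e` as an additive map. -/
noncomputable def frobeniusElementHom (e : ℕ) :
    M →+ FrobeniusPower R p e M :=
  AddMonoidHom.mk' (frobeniusElement R p e) (frobeniusElement_add R p e)

@[simp] theorem frobeniusElementHom_apply (e : ℕ) (z : M) :
    frobeniusElementHom R p e z = frobeniusElement R p e z := rfl

theorem frobeniusElementHom_smul {e f : ℕ} (h : e ≤ f) (r : R) (z : M) :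
    frobeniusElementHom R p f (r • z)
      = iterateFrobenius R p (f - e) r ^ p ^ e • frobeniusElementHom R p f z := by
  rw [frobeniusElementHom_apply, frobeniusElementHom_apply, frobeniusElement_smul,
    iterateFrobenius_def, ← pow_mul, ← pow_add, Nat.sub_add_cancel h]

/-- The Frobenius map `F^e(M) → F^f(M)`, `u ↦ u ^ p ^ (f - e)`, for `e ≤ f`. -/
noncomputable def FrobeniusPower.frob {e f : ℕ} (h : e ≤ f) :
    FrobeniusPower R p e M →+ FrobeniusPower R p f M :=
  (FrobeniusPower.lift p (iterateFrobenius R p (f - e)) (frobeniusElementHom R p f)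
    (frobeniusElementHom_smul p h)).toAddMonoidHom

@[simp] theorem FrobeniusPower.frob_frobeniusElement {e f : ℕ} (h : e ≤ f) (z : M) :
    FrobeniusPower.frob p h (frobeniusElement R p e z) = frobeniusElement R p f z :=
  FrobeniusPower.lift_frobeniusElement p (iterateFrobenius R p (f - e)) (frobeniusElementHom R p f)
    (frobeniusElementHom_smul p h) z

theorem FrobeniusPower.frob_smul {e f : ℕ} (h : e ≤ f) (r : R) (u : FrobeniusPower R p e M) :
    FrobeniusPower.frob p h (r • u) = r ^ p ^ (f - e) • FrobeniusPower.frob p h u :=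
  (FrobeniusPower.lift p (iterateFrobenius R p (f - e)) (frobeniusElementHom R p f)
    (frobeniusElementHom_smul p h)).map_smulₛₗ r u

theorem FrobeniusPower.frob_pow_smul {e f : ℕ} (h : e ≤ f) (r : R)
    (u : FrobeniusPower R p e M) :
    FrobeniusPower.frob p h (r ^ p ^ e • u) = r ^ p ^ f • FrobeniusPower.frob p h u := by
  rw [frob_smul, ← pow_mul, ← pow_add, Nat.add_sub_cancel' h]

theorem FrobeniusPower.frob_frob {e f g : ℕ} (h : e ≤ f) (h' : f ≤ g)
    (u : FrobeniusPower R p e M) :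
    FrobeniusPower.frob p h' (FrobeniusPower.frob p h u)
      = FrobeniusPower.frob p (h.trans h') u := by
  induction u using FrobeniusPower.induction with
  | elem z => simp
  | zero => simp
  | add u v hu hv => simp only [map_add, hu, hv]
  | smul r u hu =>
    rw [frob_smul, frob_smul, frob_smul, hu, ← pow_mul, ← pow_add]
    congr 3
    omega

variable {N : Type u} [AddCommGroup N] [Module R N]

@[simp] theorem FrobeniusPower.map_frobeniusElement (e : ℕ) (f : M →ₗ[R] N) (z : M) :
    FrobeniusPower.map p e f (frobeniusElement R p e z) = frobeniusElement R p e (f z) :=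
  rfl

theorem FrobeniusPower.map_frob {e f : ℕ} (h : e ≤ f) (g : M →ₗ[R] N)
    (u : FrobeniusPower R p e M) :
    FrobeniusPower.map p f g (FrobeniusPower.frob p h u)
      = FrobeniusPower.frob p h (FrobeniusPower.map p e g u) := by
  induction u using FrobeniusPower.induction with
  | elem z => simp
  | zero => simp
  | add u v hu hv => simp only [map_add, hu, hv]
  | smul r u hu => rw [frob_smul, map_smul, map_smul, frob_smul, hu]

theorem FrobeniusPower.map_surjective (e : ℕ) {f : M →ₗ[R] N} (hf : Function.Surjective f) :
    Function.Surjective (FrobeniusPower.map p e f) := by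
  intro u
  induction u using FrobeniusPower.induction with
  | elem z => obtain ⟨w, rfl⟩ := hf z; exact ⟨_, map_frobeniusElement p e f w⟩
  | zero => exact ⟨0, map_zero _⟩
  | add u v hu hv =>
    obtain ⟨a, rfl⟩ := hu
    obtain ⟨b, rfl⟩ := hv
    exact ⟨a + b, map_add _ _ _⟩
  | smul r u hu => obtain ⟨a, rfl⟩ := hu; exact ⟨r • a, map_smul _ _ _⟩

/-- The submodule `I^{[p^e]} F^e(M)` of `F^e(M)`, where `I^{[p^e]}` is generated by the
`p ^ e`-th powers of the elements of `I`. It is the kernel of `F^e(M) → F^e(M / IM)`. -/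
noncomputable def Ideal.frobeniusMul (I : Ideal R) (M : Type u) [AddCommGroup M] [Module R M]
    (e : ℕ) : Submodule R (FrobeniusPower R p e M) :=
  I.map (iterateFrobenius R p e) • ⊤

/-- Right exactness of `F^e`, for `M → M / IM`. -/
theorem FrobeniusPower.map_mkQ_eq_zero_iff (I : Ideal R) {e : ℕ} (u : FrobeniusPower R p e M) :
    FrobeniusPower.map p e (I • ⊤ : Submodule R M).mkQ u = 0 ↔ u ∈ I.frobeniusMul p M e := by
  constructor
  · -- `z ↦ z ^ p ^ e` induces a left inverse `F^e(M / IM) → F^e(M) / I^{[p^e]} F^e(M)`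
    let B := I.frobeniusMul p M e
    have hker : (I • ⊤ : Submodule R M).toAddSubgroup
        ≤ (B.mkQ.toAddMonoidHom.comp (frobeniusElementHom R p e)).ker := by
      intro z hz
      replace hz : z ∈ (I • ⊤ : Submodule R M) := hz
      change B.mkQ (frobeniusElement R p e z) = 0
      refine Submodule.smul_induction_on hz ?_ ?_
      · intro r hr n _
        rw [frobeniusElement_smul]
        exact (Submodule.Quotient.mk_eq_zero _).2
          (Submodule.smul_mem_smul (Ideal.mem_map_of_mem (iterateFrobenius R p e) hr) trivial)
      · intro x y hx hy
        rw [frobeniusElement_add, map_add, hx, hy, add_zero]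
    let g : (M ⧸ (I • ⊤ : Submodule R M)) →+ (FrobeniusPower R p e M ⧸ B) :=
      QuotientAddGroup.lift _ (B.mkQ.toAddMonoidHom.comp (frobeniusElementHom R p e)) hker
    have hgm : ∀ z : M, g (Submodule.Quotient.mk z) = B.mkQ (frobeniusElement R p e z) :=
      fun z => rfl
    let G := FrobeniusPower.lift (e := e) p (RingHom.id R) g (by
      intro r z
      obtain ⟨z, rfl⟩ := Submodule.Quotient.mk_surjective _ z
      rw [← Submodule.Quotient.mk_smul, hgm, hgm, frobeniusElement_smul, map_smul]
      rfl)
    have hG : ∀ v : FrobeniusPower R p e M,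
        G (FrobeniusPower.map p e (I • ⊤ : Submodule R M).mkQ v) = B.mkQ v := by
      intro v
      induction v using FrobeniusPower.induction with
      | elem z =>
        rw [map_frobeniusElement]
        exact (FrobeniusPower.lift_frobeniusElement p _ g _ _).trans (hgm z)
      | zero => simp
      | add u v hu hv => simp only [map_add, hu, hv]
      | smul r u hu => rw [map_smul, map_smulₛₗ, hu, map_smul]; rfl
    intro hu
    have := hG u
    rw [hu, map_zero] at this
    exact (Submodule.Quotient.mk_eq_zero _).1 this.symm
  · intro hu
    refine (Submodule.smul_le (P := LinearMap.ker (FrobeniusPower.map p e _))).2 ?_ hu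
    intro r hr n _
    rw [LinearMap.mem_ker, map_smul]
    -- it is enough that `r ^ p ^ e` kills `F^e(M / IM)` for `r ∈ I`
    generalize FrobeniusPower.map p e (I • ⊤ : Submodule R M).mkQ n = v
    induction hr using Submodule.span_induction with
    | mem x hx =>
      obtain ⟨s, hs, rfl⟩ := hx
      induction v using FrobeniusPower.induction with
      | elem z =>
        obtain ⟨z, rfl⟩ := Submodule.Quotient.mk_surjective _ z
        change s ^ p ^ e • _ = _
        rw [← frobeniusElement_smul, ← Submodule.Quotient.mk_smul,
          (Submodule.Quotient.mk_eq_zero _).2 (Submodule.smul_mem_smul hs Submodule.mem_top),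
          frobeniusElement_zero]
      | zero => exact smul_zero _
      | add u v hu hv => rw [smul_add, hu, hv, add_zero]
      | smul r u hu => rw [smul_comm, hu, smul_zero]
    | zero => exact zero_smul _ _
    | add x y _ _ hx hy => rw [add_smul, hx, hy, add_zero]
    | smul a x _ hx => rw [smul_eq_mul, mul_smul, hx, smul_zero]

/-- `F^k(F^e(M))` may be identified with `F^{e + k}(M)`, so that the `p ^ k`-th power of
`u ∈ F^e(M)` becomes its Frobenius image. -/
theorem smul_frobeniusElement_eq_zero_iff {e k f : ℕ} (h : e ≤ f) (hf : f = e + k) (d : R)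
    (u : FrobeniusPower R p e M) :
    d • frobeniusElement R p k u = 0 ↔ d • FrobeniusPower.frob p h u = 0 := by
  subst hf
  constructor
  · intro h0
    have hg : ∀ (r : R) (z : FrobeniusPower R p e M), FrobeniusPower.frob p h (r • z)
        = RingHom.id R r ^ p ^ k • FrobeniusPower.frob p h z := by
      intro r z
      rw [FrobeniusPower.frob_smul, Nat.add_sub_cancel_left]
      rfl
    let F := FrobeniusPower.lift (e := k) p (RingHom.id R) (FrobeniusPower.frob p h) hg
    have h1 := congrArg F h0
    rw [map_smulₛₗ, map_zero] at h1
    refine Eq.trans (congrArg (d • ·) ?_) h1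
    exact (FrobeniusPower.lift_frobeniusElement p (RingHom.id R)
      (FrobeniusPower.frob p h) hg u).symm
  · intro h0
    let F := FrobeniusPower.lift (e := e + k) p (RingHom.id R)
      ((frobeniusElementHom (M := FrobeniusPower R p e M) R p k).comp
        (frobeniusElementHom (M := M) R p e)) (by
        intro r z
        change frobeniusElement R p k (frobeniusElement R p e (r • z))
          = r ^ p ^ (e + k) • frobeniusElement R p k (frobeniusElement R p e z)
        rw [frobeniusElement_smul, frobeniusElement_smul, ← pow_mul, ← pow_add])
    have hF : ∀ v : FrobeniusPower R p e M,
        F (FrobeniusPower.frob p h v) = frobeniusElement R p k v := by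
      intro v
      induction v using FrobeniusPower.induction with
      | elem z =>
        rw [FrobeniusPower.frob_frobeniusElement]
        exact FrobeniusPower.lift_frobeniusElement p _ _ _ z
      | zero => rw [map_zero, map_zero, frobeniusElement_zero]
      | add u v hu hv => rw [map_add, map_add, hu, hv, frobeniusElement_add]
      | smul r u hu =>
        rw [FrobeniusPower.frob_smul, map_smulₛₗ, hu, frobeniusElement_smul,
          Nat.add_sub_cancel_left]
        rfl
    have h1 := congrArg F h0
    rw [map_smulₛₗ, map_zero, hF] at h1
    exact h1

theorem frobeniusPower_bot (e : ℕ) :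
    (⊥ : Submodule R M).frobeniusPower p e = ⊥ := by
  refine (Submodule.eq_bot_iff _).2 ?_
  rintro _ ⟨v, rfl⟩
  induction v using FrobeniusPower.induction with
  | elem z =>
    rw [FrobeniusPower.map_frobeniusElement, Subsingleton.elim z 0, map_zero,
      frobeniusElement_zero]
  | zero => exact map_zero _
  | add u v hu hv => rw [map_add, hu, hv, add_zero]
  | smul r u hu => rw [map_smul, hu, smul_zero]

end FrobeniusPower

/-! ### Tight closure modulo an ideal and phantom nonzerodivisors -/

section RelativeTightClosure

variable {A : Type u} [CommRing A] (p : ℕ) [Fact p.Prime] [CharP A p]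
  (M : Type u) [AddCommGroup M] [Module A M]

/-- The preimage in `F^e(M)` of the tight closure of zero in `F^e(M / IM)`; equivalently, the
tight closure of `I^{[p^e]} F^e(M)` in `F^e(M)`. -/
noncomputable def Ideal.frobeniusTightClosure (I : Ideal A) (e : ℕ) :
    Submodule A (FrobeniusPower A p e M) :=
  ((⊥ : Submodule A (FrobeniusPower A p e (M ⧸ (I • ⊤ : Submodule A M)))).tightClosure p).comap
    (FrobeniusPower.map p e (I • ⊤ : Submodule A M).mkQ)

/-- `x` is phantom regular on `M / IM`, apart from the condition `x (M / IM) ≠ M / IM`. The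
condition on `F^e(M / IM)` is expressed in `F^e(M)`, so that along a sequence the module stays fixed
and only the ideal grows. -/
def IsPhantomNonzerodivisor (I : Ideal A) (x : A) : Prop :=
  ∀ (e : ℕ) (u : FrobeniusPower A p e M), x ^ p ^ e • u ∈ I.frobeniusMul p M e →
    u ∈ I.frobeniusTightClosure p M e

variable {M}

theorem smul_frobeniusElement_mkQ_mem_iff (I : Ideal A) {e k f : ℕ} (h : e ≤ f) (hf : f = e + k)
    (d : A) (u : FrobeniusPower A p e M) :
    d • frobeniusElement A p k (FrobeniusPower.map p e (I • ⊤ : Submodule A M).mkQ u)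
        ∈ (⊥ : Submodule A (FrobeniusPower A p e (M ⧸ (I • ⊤ : Submodule A M)))).frobeniusPower p k
      ↔ d • FrobeniusPower.frob p h u ∈ I.frobeniusMul p M f := by
  rw [frobeniusPower_bot, Submodule.mem_bot, smul_frobeniusElement_eq_zero_iff p h hf,
    ← FrobeniusPower.map_frob, ← map_smul, FrobeniusPower.map_mkQ_eq_zero_iff]

theorem mem_frobeniusTightClosure_iff {I : Ideal A} {e : ℕ} {u : FrobeniusPower A p e M} :
    u ∈ I.frobeniusTightClosure p M e ↔ ∃ d ∈ complMinimalPrimes A, ∃ f₀ : ℕ,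
      ∀ (f : ℕ) (h : e ≤ f), f₀ ≤ f → d • FrobeniusPower.frob p h u ∈ I.frobeniusMul p M f := by
  constructor
  · rintro ⟨d, hd, k₀, H⟩
    refine ⟨d, hd, e + k₀, fun f h hf => ?_⟩
    exact (smul_frobeniusElement_mkQ_mem_iff p I h (k := f - e) (by omega) d u).1
      (H (f - e) (by omega))
  · rintro ⟨d, hd, f₀, H⟩
    refine ⟨d, hd, f₀, fun k hk => ?_⟩
    exact (smul_frobeniusElement_mkQ_mem_iff p I (Nat.le_add_right e k) rfl d u).2
      (H _ _ (by omega))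

theorem Ideal.frobeniusMul_mono {I J : Ideal A} (h : I ≤ J) (e : ℕ) :
    I.frobeniusMul p M e ≤ J.frobeniusMul p M e :=
  Submodule.smul_mono_left (Ideal.map_mono h)

theorem Ideal.frobeniusTightClosure_mono {I J : Ideal A} (h : I ≤ J) (e : ℕ) :
    I.frobeniusTightClosure p M e ≤ J.frobeniusTightClosure p M e := by
  intro u hu
  rw [mem_frobeniusTightClosure_iff] at hu ⊢
  obtain ⟨d, hd, f₀, H⟩ := hu
  exact ⟨d, hd, f₀, fun f hf hf₀ => I.frobeniusMul_mono p h f (H f hf hf₀)⟩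

theorem mem_frobeniusMul_sup_span_iff {I : Ideal A} {x : A} {e : ℕ}
    {u : FrobeniusPower A p e M} :
    u ∈ (I ⊔ Ideal.span {x}).frobeniusMul p M e ↔
      ∃ v : FrobeniusPower A p e M, u - x ^ p ^ e • v ∈ I.frobeniusMul p M e := by
  unfold Ideal.frobeniusMul
  rw [Ideal.map_sup, Ideal.map_span, Set.image_singleton, Submodule.sup_smul,
    Submodule.ideal_span_singleton_smul, Submodule.mem_sup]
  constructor
  · rintro ⟨a, ha, b, ⟨v, -, rfl⟩, rfl⟩
    exact ⟨v, by simpa [iterateFrobenius_def] using ha⟩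
  · rintro ⟨v, hv⟩
    exact ⟨_, hv, x ^ p ^ e • v, ⟨v, Submodule.mem_top, rfl⟩, by simp⟩

theorem FrobeniusPower.frob_mem_frobeniusMul {I : Ideal A} {e f : ℕ} (h : e ≤ f)
    {u : FrobeniusPower A p e M} (hu : u ∈ I.frobeniusMul p M e) :
    FrobeniusPower.frob p h u ∈ I.frobeniusMul p M f := by
  rw [← map_mkQ_eq_zero_iff] at hu ⊢
  rw [map_frob, hu, map_zero]

theorem Ideal.frobeniusMul_le_frobeniusTightClosure (I : Ideal A) (e : ℕ) :
    I.frobeniusMul p M e ≤ I.frobeniusTightClosure p M e := by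
  intro u hu
  rw [mem_frobeniusTightClosure_iff]
  exact ⟨1, one_mem _, 0, fun f h _ => by
    rw [one_smul]; exact FrobeniusPower.frob_mem_frobeniusMul p h hu⟩

theorem pow_smul_mem_frobeniusMul_sup_span (I : Ideal A) (x : A) {e : ℕ}
    (v : FrobeniusPower A p e M) :
    x ^ p ^ e • v ∈ (I ⊔ Ideal.span {x}).frobeniusMul p M e :=
  (mem_frobeniusMul_sup_span_iff p).2 ⟨v, by rw [sub_self]; exact zero_mem _⟩

/-- Regularity modulo the tight closures `I^{[p^e]} F^e(M)^*` implies phantom regularity. -/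
theorem IsPhantomNonzerodivisor.of_smul_mem {I : Ideal A} {x : A}
    (h : ∀ (e : ℕ) (u : FrobeniusPower A p e M), x • u ∈ I.frobeniusTightClosure p M e →
      u ∈ I.frobeniusTightClosure p M e) : IsPhantomNonzerodivisor p M I x := by
  intro e u hu
  replace hu := I.frobeniusMul_le_frobeniusTightClosure p e hu
  generalize p ^ e = n at hu
  induction n with
  | zero => simpa using hu
  | succ n ih => exact ih (h e _ (by rwa [smul_smul, ← pow_succ']))

section TestElement

variable {p} {e₀ : ℕ} {c : A} [Module.Finite A M]

/-- A weak test element turns tight closure into a family of plain conditions, uniform in the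
element. -/
theorem IsWeakTestElement.mem_frobeniusTightClosure_iff (hc : IsWeakTestElement A p e₀ c)
    {I : Ideal A} {e : ℕ} {u : FrobeniusPower A p e M} :
    u ∈ I.frobeniusTightClosure p M e ↔ ∀ (f : ℕ) (h : e ≤ f), e + e₀ ≤ f →
      c • FrobeniusPower.frob p h u ∈ I.frobeniusMul p M f := by
  constructor
  · intro hu f h hf
    refine (smul_frobeniusElement_mkQ_mem_iff p I h (k := f - e) (by omega) c u).1 ?_
    exact hc.2 (FrobeniusPower A p e (M ⧸ (I • ⊤ : Submodule A M))) ⊥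
      (FrobeniusPower.map p e (I • ⊤ : Submodule A M).mkQ u) hu (f - e) (by omega)
  · intro H
    exact (_root_.mem_frobeniusTightClosure_iff p).2 ⟨c, hc.1, e + e₀, H⟩

/-- Tight closure is idempotent, in the following form: if a fixed multiple of all large Frobenius
images of `u` lies in the tight closure of `I^{[p^f]} F^f(M)`, then `u` lies in the tight closure
of `I^{[p^e]} F^e(M)`. -/
theorem IsWeakTestElement.mem_of_smul_frob_mem (hc : IsWeakTestElement A p e₀ c)
    {I : Ideal A} {e : ℕ} {u : FrobeniusPower A p e M} {d : A} (hd : d ∈ complMinimalPrimes A)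
    {f₀ : ℕ} (H : ∀ (f : ℕ) (h : e ≤ f), f₀ ≤ f →
      d • FrobeniusPower.frob p h u ∈ I.frobeniusTightClosure p M f) :
    u ∈ I.frobeniusTightClosure p M e := by
  refine (_root_.mem_frobeniusTightClosure_iff p).2
    ⟨c * d ^ p ^ e₀, mul_mem hc.1 (pow_mem hd _), max e f₀ + e₀, fun g h hg => ?_⟩
  have h1 : e ≤ g - e₀ := by omega
  have h2 : g - e₀ ≤ g := by omega
  -- the test element applies after `e₀` further Frobenius steps, which turn `d` into `d ^ p ^ e₀`
  have := hc.mem_frobeniusTightClosure_iff.1 (H (g - e₀) h1 (by omega)) g h2 (by omega)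
  rwa [FrobeniusPower.frob_smul, FrobeniusPower.frob_frob, show g - (g - e₀) = e₀ by omega,
    smul_smul] at this

/-- A phantom regular element is regular modulo the tight closures `I^{[p^e]} F^e(M)^*`. -/
theorem IsPhantomNonzerodivisor.mem_of_smul_mem (hc : IsWeakTestElement A p e₀ c)
    {I : Ideal A} {x : A} (hx : IsPhantomNonzerodivisor p M I x) {e : ℕ}
    {u : FrobeniusPower A p e M} (hu : x • u ∈ I.frobeniusTightClosure p M e) :
    u ∈ I.frobeniusTightClosure p M e := by
  refine hc.mem_of_smul_frob_mem hc.1 (f₀ := e + e₀) fun f h hf => hx f _ ?_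
  have h1 := hc.mem_frobeniusTightClosure_iff.1 hu f h hf
  rw [FrobeniusPower.frob_smul] at h1
  -- raise the exponent of `x` from `p ^ (f - e)` to the exponent `p ^ f` of phantom regularity
  have h2 := Submodule.smul_mem _ (x ^ (p ^ f - p ^ (f - e))) h1
  rwa [smul_comm c, smul_smul, ← pow_add, Nat.sub_add_cancel] at h2
  exact Nat.pow_le_pow_right (Fact.out : p.Prime).pos (Nat.sub_le _ _)

theorem IsPhantomNonzerodivisor.mem_of_pow_smul_mem (hc : IsWeakTestElement A p e₀ c)
    {I : Ideal A} {x : A} (hx : IsPhantomNonzerodivisor p M I x) {e n : ℕ}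
    {u : FrobeniusPower A p e M} (hu : x ^ n • u ∈ I.frobeniusTightClosure p M e) :
    u ∈ I.frobeniusTightClosure p M e := by
  induction n with
  | zero => simpa using hu
  | succ n ih => exact ih (hx.mem_of_smul_mem hc (by rwa [smul_smul, ← pow_succ']))

/-- Cancellation in a relation `x ^ q u = z ^ q v` whose right-hand factor `v` is tightly in
`(I, x)`: the factor `u` is then tightly in `(I, z)`. -/
theorem IsPhantomNonzerodivisor.mem_of_relation (hc : IsWeakTestElement A p e₀ c)
    {I : Ideal A} {x z : A} (hx : IsPhantomNonzerodivisor p M I x) {e : ℕ}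
    {u v : FrobeniusPower A p e M} (huv : x ^ p ^ e • u - z ^ p ^ e • v ∈ I.frobeniusMul p M e)
    (hv : v ∈ (I ⊔ Ideal.span {x}).frobeniusTightClosure p M e) :
    u ∈ (I ⊔ Ideal.span {z}).frobeniusTightClosure p M e := by
  refine hc.mem_of_smul_frob_mem hc.1 (f₀ := e + e₀) fun f h hf => ?_
  obtain ⟨s, hs⟩ := (mem_frobeniusMul_sup_span_iff p).1
    (hc.mem_frobeniusTightClosure_iff.1 hv f h hf)
  have h1 := FrobeniusPower.frob_mem_frobeniusMul p h huv
  rw [map_sub, FrobeniusPower.frob_pow_smul, FrobeniusPower.frob_pow_smul] at h1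
  have h2 : c • FrobeniusPower.frob p h u - z ^ p ^ f • s ∈ I.frobeniusTightClosure p M f := by
    apply hx
    have := add_mem (Submodule.smul_mem _ c h1) (Submodule.smul_mem _ (z ^ p ^ f) hs)
    convert this using 1
    module
  have h3 := (I ⊔ Ideal.span {z}).frobeniusMul_le_frobeniusTightClosure p f
    (pow_smul_mem_frobeniusMul_sup_span p I z s)
  simpa using add_mem (Ideal.frobeniusTightClosure_mono p le_sup_left f h2) h3

/-- If `x, z` is phantom regular, then `x` is phantom regular modulo `z`. -/
theorem IsPhantomNonzerodivisor.swap (hc : IsWeakTestElement A p e₀ c)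
    {I : Ideal A} {x z : A} (hx : IsPhantomNonzerodivisor p M I x)
    (hz : IsPhantomNonzerodivisor p M (I ⊔ Ideal.span {x}) z) :
    IsPhantomNonzerodivisor p M (I ⊔ Ideal.span {z}) x := by
  intro e u hu
  obtain ⟨v, hv⟩ := (mem_frobeniusMul_sup_span_iff p).1 hu
  refine hx.mem_of_relation hc hv (hz e v ((mem_frobeniusMul_sup_span_iff p).2 ⟨u, ?_⟩))
  simpa using neg_mem hv

/-- If `y, w` is phantom regular modulo `I` and `x` is phantom regular modulo `I`, then an element
multiplied by both `y` and `w` into the tight closure attached to `(I, x)` lies there itself.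
This is the tight closure form of the fact that, for `N = A / (y, w)` and `x`, `y`, `w` as above
modulo `I = 0`, the vanishing of `Hom(N, M)` and `Ext¹(N, M)` forces `Hom(N, M / xM) = 0`. -/
theorem IsPhantomNonzerodivisor.mem_of_smul_mem_of_smul_mem (hc : IsWeakTestElement A p e₀ c)
    {I : Ideal A} {x y w : A} (hx : IsPhantomNonzerodivisor p M I x)
    (hy : IsPhantomNonzerodivisor p M I y)
    (hw : IsPhantomNonzerodivisor p M (I ⊔ Ideal.span {y}) w) {e : ℕ}
    {u : FrobeniusPower A p e M}
    (hyu : y • u ∈ (I ⊔ Ideal.span {x}).frobeniusTightClosure p M e)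
    (hwu : w • u ∈ (I ⊔ Ideal.span {x}).frobeniusTightClosure p M e) :
    u ∈ (I ⊔ Ideal.span {x}).frobeniusTightClosure p M e := by
  refine hc.mem_of_smul_frob_mem hc.1 (f₀ := e + e₀) fun f h hf => ?_
  have h1 := hc.mem_frobeniusTightClosure_iff.1 hyu f h hf
  have h2 := hc.mem_frobeniusTightClosure_iff.1 hwu f h hf
  rw [FrobeniusPower.frob_smul] at h1 h2
  replace h1 := Submodule.smul_mem _ (y ^ (p ^ f - p ^ (f - e))) h1
  rw [smul_comm c, smul_smul, ← pow_add, Nat.sub_add_cancel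
    (Nat.pow_le_pow_right (Fact.out : p.Prime).pos (Nat.sub_le _ _))] at h1
  obtain ⟨v, hv⟩ := (mem_frobeniusMul_sup_span_iff p).1 h1
  obtain ⟨t, ht⟩ := (mem_frobeniusMul_sup_span_iff p).1 h2
  refine hy.mem_of_relation hc hv (hw.mem_of_pow_smul_mem hc (n := p ^ (f - e)) ?_)
  -- the two relations for `c u ^ p ^ (f - e)`, cross-multiplied, make `w ^ p ^ (f - e) v` a
  -- multiple of `y ^ p ^ f` up to tight closure, after cancelling `x`
  have h3 : w ^ p ^ (f - e) • v - y ^ p ^ f • t ∈ I.frobeniusTightClosure p M f := by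
    apply hx
    have := sub_mem (Submodule.smul_mem _ (y ^ p ^ f) ht)
      (Submodule.smul_mem _ (w ^ p ^ (f - e)) hv)
    convert this using 1
    module
  have h4 := (I ⊔ Ideal.span {y}).frobeniusMul_le_frobeniusTightClosure p f
    (pow_smul_mem_frobeniusMul_sup_span p I y t)
  simpa using add_mem (Ideal.frobeniusTightClosure_mono p le_sup_left f h3) h4

end TestElement

end RelativeTightClosure

/-! ### Exchange of phantom regular elements -/

section Exchange

variable {A : Type u} [CommRing A] [IsLocalRing A] (p : ℕ) [Fact p.Prime] [CharP A p]
  (M : Type u) [AddCommGroup M] [Module A M]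

/-- There is a sequence of length `n` in the maximal ideal each of whose members is a phantom
nonzerodivisor modulo `I` and its predecessors. -/
def HasPhantomSequence : ℕ → Ideal A → Prop
  | 0, _ => True
  | n + 1, I => ∃ x ∈ IsLocalRing.maximalIdeal A, IsPhantomNonzerodivisor p M I x ∧
      HasPhantomSequence n (I ⊔ Ideal.span {x})

/-- For any two ideals `I`, `J`, a common phantom nonzerodivisor modulo `I` and modulo `J` can be
found in the maximal ideal as soon as the maximal ideal annihilates no nonzero element of any of the
modules `G^e(M / IM)`, `G^e(M / JM)`. -/
def HasCommonPhantomNonzerodivisors : Prop :=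
  ∀ I J : Ideal A,
    (∀ K ∈ ({I, J} : Set (Ideal A)), ∀ (e : ℕ) (u : FrobeniusPower A p e M),
      (∀ a ∈ IsLocalRing.maximalIdeal A, a • u ∈ K.frobeniusTightClosure p M e) →
        u ∈ K.frobeniusTightClosure p M e) →
    ∃ z ∈ IsLocalRing.maximalIdeal A,
      IsPhantomNonzerodivisor p M I z ∧ IsPhantomNonzerodivisor p M J z

variable {p M} {e₀ : ℕ} {c : A} [Module.Finite A M]

/-- Passing to the quotient by an arbitrary phantom regular element shortens phantom regular
sequences by one at most. -/
theorem HasPhantomSequence.exchange (hc : IsWeakTestElement A p e₀ c)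
    (hA : HasCommonPhantomNonzerodivisors (A := A) p M) {n : ℕ} {I : Ideal A}
    (hI : HasPhantomSequence p M (n + 1) I) {x : A} (hxm : x ∈ IsLocalRing.maximalIdeal A)
    (hx : IsPhantomNonzerodivisor p M I x) :
    HasPhantomSequence p M n (I ⊔ Ideal.span {x}) := by
  induction n generalizing I x with
  | zero => trivial
  | succ n ih =>
    obtain ⟨y, hym, hy, hIy⟩ := hI
    obtain ⟨w, hwm, hw, -⟩ := id hIy
    obtain ⟨z, hzm, hzx, hzy⟩ := hA (I ⊔ Ideal.span {x}) (I ⊔ Ideal.span {y}) (by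
      rintro K (rfl | rfl) e u hu
      · exact hx.mem_of_smul_mem_of_smul_mem hc hy hw (hu y hym) (hu w hwm)
      · exact hw.mem_of_smul_mem hc (hu w hwm))
    -- `z` links the sequences starting with `y` to those starting with `x`:
    -- the sequence modulo `I` starting with `y` gives one modulo `(I, z)`, again starting with `y`
    have hIz : HasPhantomSequence p M (n + 1) (I ⊔ Ideal.span {z}) :=
      ⟨y, hym, hy.swap hc hzy, by
        rw [sup_right_comm]
        exact ih hIy hzm hzy⟩
    refine ⟨z, hzm, hzx, ?_⟩
    rw [sup_right_comm]
    exact ih hIz hxm (hx.swap hc hzx)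

end Exchange

/-! ### Complete local rings -/

section CompleteLocal

/-- In a complete Noetherian local ring, if the maximal ideal is contained in a countable union of
prime ideals, then it is one of them. -/
theorem IsLocalRing.exists_mem_maximalIdeal_forall_notMem {A : Type u} [CommRing A]
    [IsLocalRing A] [IsNoetherianRing A] [IsAdicComplete (IsLocalRing.maximalIdeal A) A]
    {Ps : Set (Ideal A)} (hcount : Ps.Countable) (hprime : ∀ P ∈ Ps, P.IsPrime)
    (hmax : IsLocalRing.maximalIdeal A ∉ Ps) :
    ∃ z ∈ IsLocalRing.maximalIdeal A, ∀ P ∈ Ps, z ∉ P := by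
  set m := IsLocalRing.maximalIdeal A with hm
  rcases Ps.eq_empty_or_nonempty with rfl | hne
  · exact ⟨0, zero_mem _, by simp⟩
  obtain ⟨P, rfl⟩ := hcount.exists_eq_range hne
  have hP : ∀ n, (P n).IsPrime := fun n => hprime _ ⟨n, rfl⟩
  have hmP : ∀ n, ¬ m ≤ P n := fun n hle => hmax
    ⟨n, ((IsLocalRing.maximalIdeal.isMaximal A).eq_of_le (hP n).ne_top hle).symm⟩
  -- a small perturbation moves `z` out of `P n`, and since `P n` is closed it stays out
  -- under all sufficiently small further perturbations
  have step : ∀ (n : ℕ) (z : A) (k : ℕ), ∃ (z' : A) (k' : ℕ),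
      k < k' ∧ z' - z ∈ m ^ k ∧ ∀ t ∈ m ^ k', z' + t ∉ P n := by
    intro n z k
    obtain ⟨z', hz', hzP⟩ : ∃ z', z' - z ∈ m ^ k ∧ z' ∉ P n := by
      by_cases hz : z ∈ P n
      · obtain ⟨t, htm, htP⟩ := SetLike.not_le_iff_exists.1
          fun h => hmP n ((hP n).le_of_pow_le h)
        exact ⟨z + t, by simpa using htm, fun h => htP ((Submodule.add_mem_iff_right _ hz).1 h)⟩
      · exact ⟨z, by simp, hz⟩
    obtain ⟨k', hk'⟩ : ∃ k', ∀ t ∈ m ^ k', z' + t ∉ P n := by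
      by_contra! hcon
      refine hzP (Ideal.Quotient.eq_zero_iff_mem.1
        (IsHausdorff.haus (I := m) (M := A ⧸ P n) inferInstance _ fun k => ?_))
      obtain ⟨t, ht, htP⟩ := hcon k
      rw [SModEq.zero]
      have h1 : Ideal.Quotient.mk (P n) z' = -(t • (1 : A ⧸ P n)) := by
        rw [eq_neg_iff_add_eq_zero]
        have := Ideal.Quotient.eq_zero_iff_mem.2 htP
        rw [map_add] at this
        rwa [Algebra.smul_def, mul_one]
      rw [h1]
      exact neg_mem (Submodule.smul_mem_smul ht Submodule.mem_top)
    exact ⟨z', max k' (k + 1), by omega, hz', fun t ht =>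
      hk' t (Ideal.pow_le_pow_right (le_max_left _ _) ht)⟩
  choose F K hK hF hFP using step
  let s : ℕ → A × ℕ := fun n => Nat.rec (0, 1) (fun n q => (F n q.1 q.2, K n q.1 q.2)) n
  have hsmono : StrictMono fun n => (s n).2 := strictMono_nat_of_lt_succ fun n => hK n _ _
  have hle : ∀ n, n ≤ (s n).2 := hsmono.id_le
  have hcauchy : ∀ {i j : ℕ}, i ≤ j → (s j).1 - (s i).1 ∈ m ^ (s i).2 := by
    intro i j hij
    induction j, hij using Nat.le_induction with
    | base => simp
    | succ j hij ih =>
      have h1 := Ideal.pow_le_pow_right (I := m) (hsmono.monotone hij) (hF j (s j).1 (s j).2)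
      simpa using add_mem h1 ih
  obtain ⟨z, hz⟩ := IsPrecomplete.prec (I := m) (M := A) inferInstance (f := fun n => (s n).1)
    (fun {i j} hij => by
      rw [SModEq.comm, SModEq.sub_mem, smul_eq_mul, Ideal.mul_top]
      exact Ideal.pow_le_pow_right (hle i) (hcauchy hij))
  have hzs : ∀ n, z - (s n).1 ∈ m ^ (s n).2 := by
    intro n
    have h1 := hz (s n).2
    rw [SModEq.comm, SModEq.sub_mem, smul_eq_mul, Ideal.mul_top] at h1
    simpa using add_mem h1 (hcauchy (hle n))
  refine ⟨z, by simpa [s] using hzs 0, ?_⟩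
  rintro _ ⟨n, rfl⟩ hzn
  refine hFP n (s n).1 (s n).2 _ (hzs (n + 1)) ?_
  change (s (n + 1)).1 + _ ∈ _
  simpa using hzn

open MvPolynomial in
/-- The completion of a Noetherian ring at an ideal generated by `n` elements is a quotient of a
power series ring in `n` variables. -/
theorem AdicCompletion.isNoetherianRing {R : Type u} [CommRing R] [IsNoetherianRing R]
    (I : Ideal R) : IsNoetherianRing (AdicCompletion I R) := by
  obtain ⟨n, a, ha⟩ := Submodule.fg_iff_exists_fin_generating_family.1
    (IsNoetherian.noetherian I)
  let J : Ideal (MvPolynomial (Fin n) R) := idealOfVars (Fin n) R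
  have hJ : J.FG := idealOfVars_fg (Fin n) R
  have : IsNoetherianRing (AdicCompletion J (MvPolynomial (Fin n) R)) :=
    isNoetherianRing_of_ringEquiv _ (MvPowerSeries.toAdicCompletionAlgEquiv (Fin n) R).toRingEquiv
  let g : MvPolynomial (Fin n) R →+* R := (aeval a : _ →ₐ[R] R)
  have hgJ : J.map g = I := by
    rw [← ha]
    simp only [J, idealOfVars, Ideal.map_span, ← Set.range_comp]
    congr 2
    ext i
    simp [g]
  have hgJk : ∀ k, J ^ k ≤ (I ^ k).comap g := fun k => by
    rw [← Ideal.map_le_iff_le_comap, Ideal.map_pow, hgJ]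
  let f : (k : ℕ) → AdicCompletion J (MvPolynomial (Fin n) R) →+* R ⧸ I ^ k := fun k =>
    (Ideal.quotientMap (I ^ k) g (hgJk k)).comp (AdicCompletion.evalₐ J k : _ →+* _)
  have hf : ∀ {i j : ℕ} (hle : i ≤ j), (Ideal.Quotient.factorPow I hle).comp (f j) = f i := by
    intro i j hle
    ext x
    induction x using AdicCompletion.induction_on with
    | _ x =>
      simp only [f, RingHom.comp_apply, RingHom.coe_coe, AdicCompletion.evalₐ_mk,
        Ideal.quotientMap_mk]
      change Ideal.Quotient.mk (I ^ i) (g (x.val j)) = Ideal.Quotient.mk (I ^ i) (g (x.val i))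
      rw [← Ideal.quotientMap_mk (f := g) (H := hgJk i), ← Ideal.quotientMap_mk (f := g)
        (H := hgJk i), AdicCompletion.Ideal.mk_eq_mk J hle]
  let G := AdicCompletion.liftRingHom I f hf
  have : IsAdicComplete (J.map (algebraMap _ (AdicCompletion J (MvPolynomial (Fin n) R))))
    (AdicCompletion J (MvPolynomial (Fin n) R)) := AdicCompletion.isAdicComplete_self J hJ
  have hGalg : ∀ q : MvPolynomial (Fin n) R, G (algebraMap _ _ q) = algebraMap _ _ (g q) := by
    intro q
    refine AdicCompletion.ext_evalₐ fun k => ?_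
    rw [AdicCompletion.evalₐ_liftRingHom, AdicCompletion.algebraMap_apply,
      AdicCompletion.algebraMap_apply]
    simp [f]
  have hmap : (J.map (algebraMap _ (AdicCompletion J (MvPolynomial (Fin n) R)))).map G
      = I.map (algebraMap R (AdicCompletion I R)) := by
    have hcomp : G.comp (algebraMap (MvPolynomial (Fin n) R) _) = (algebraMap R _).comp g :=
      RingHom.ext hGalg
    rw [Ideal.map_map, hcomp, ← Ideal.map_map, hgJ]
  have hfgI := IsNoetherian.noetherian I
  have hcI := AdicCompletion.isAdicComplete_self I hfgI
  have : IsHausdorff ((J.map (algebraMap _ (AdicCompletion J (MvPolynomial (Fin n) R)))).map G)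
      (AdicCompletion I R) := by
    rw [hmap]; infer_instance
  refine isNoetherianRing_of_surjective _ _ G
    (surjective_of_mk_map_comp_surjective (I := J.map (algebraMap _ _)) G ?_)
  rw [hmap]
  intro y
  obtain ⟨y, rfl⟩ := Ideal.Quotient.mk_surjective y
  obtain ⟨r, hr⟩ := Ideal.Quotient.mk_surjective (AdicCompletion.evalOneₐ I y)
  refine ⟨algebraMap (MvPolynomial (Fin n) R) (AdicCompletion J (MvPolynomial (Fin n) R)) (C r),
    Ideal.Quotient.eq.2 ?_⟩
  rw [hGalg, ← AdicCompletion.ker_evalOneₐ_eq_map I hfgI, RingHom.mem_ker, map_sub, sub_eq_zero]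
  simp only [g, RingHom.coe_coe, aeval_C, Algebra.algebraMap_self, RingHom.id_apply]
  exact (congrArg (fun φ : R →+* R ⧸ I => φ r)
    (AdicCompletion.evalOneₐ_comp_algebraMap_eq_mk I)).trans hr

end CompleteLocal

/-! ### Associated primes and avoidance -/

section AssociatedPrimes

variable {A : Type u} [CommRing A] (p : ℕ) [Fact p.Prime] [CharP A p]
  {M : Type u} [AddCommGroup M] [Module A M]

theorem mk_map_mkQ_eq_zero_iff {I : Ideal A} {e : ℕ} {u : FrobeniusPower A p e M} :
    (Submodule.Quotient.mk (FrobeniusPower.map p e (I • ⊤ : Submodule A M).mkQ u) :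
      ReducedFrobeniusPower A p (M ⧸ (I • ⊤ : Submodule A M)) e) = 0 ↔
      u ∈ I.frobeniusTightClosure p M e :=
  Submodule.Quotient.mk_eq_zero _

theorem exists_mk_map_mkQ_eq (I : Ideal A) {e : ℕ}
    (w : ReducedFrobeniusPower A p (M ⧸ (I • ⊤ : Submodule A M)) e) :
    ∃ u : FrobeniusPower A p e M,
      Submodule.Quotient.mk (FrobeniusPower.map p e (I • ⊤ : Submodule A M).mkQ u) = w := by
  obtain ⟨w, rfl⟩ := Submodule.Quotient.mk_surjective _ w
  obtain ⟨u, rfl⟩ := FrobeniusPower.map_surjective p e (Submodule.mkQ_surjective _) w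
  exact ⟨u, rfl⟩

theorem isPhantomNonzerodivisor_of_notMem_associatedPrimes [IsNoetherianRing A]
    {I : Ideal A} {x : A}
    (h : ∀ e : ℕ, ∀ P ∈ associatedPrimes A
      (ReducedFrobeniusPower A p (M ⧸ (I • ⊤ : Submodule A M)) e), x ∉ P) :
    IsPhantomNonzerodivisor p M I x := by
  refine IsPhantomNonzerodivisor.of_smul_mem p fun e u hu => ?_
  by_contra hnot
  have hx : x ∈ ⋃ P ∈ associatedPrimes A
      (ReducedFrobeniusPower A p (M ⧸ (I • ⊤ : Submodule A M)) e), (P : Set A) := by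
    rw [biUnion_associatedPrimes_eq_zero_divisors]
    refine ⟨Submodule.Quotient.mk (FrobeniusPower.map p e (I • ⊤ : Submodule A M).mkQ u),
      fun h0 => hnot ((mk_map_mkQ_eq_zero_iff p).1 h0), ?_⟩
    rw [← Submodule.Quotient.mk_smul, ← map_smul]
    exact (mk_map_mkQ_eq_zero_iff p).2 hu
  obtain ⟨P, hP, hxP⟩ := Set.mem_iUnion₂.1 hx
  exact h e P hP hxP

theorem exists_notMem_of_mem_associatedPrimes [IsNoetherianRing A] {I P : Ideal A} {e : ℕ}
    (hP : P ∈ associatedPrimes A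
      (ReducedFrobeniusPower A p (M ⧸ (I • ⊤ : Submodule A M)) e)) :
    ∃ u : FrobeniusPower A p e M, u ∉ I.frobeniusTightClosure p M e ∧
      ∀ a ∈ P, a • u ∈ I.frobeniusTightClosure p M e := by
  obtain ⟨hprime, w, hw⟩ := isAssociatedPrime_iff.1 hP
  obtain ⟨u, rfl⟩ := exists_mk_map_mkQ_eq p I w
  refine ⟨u, fun hu => hprime.ne_top ?_, fun a ha => ?_⟩
  · rw [hw, (mk_map_mkQ_eq_zero_iff p).2 hu]
    simp
  · rw [hw, Submodule.mem_colon_singleton, Submodule.mem_bot, ← Submodule.Quotient.mk_smul,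
      ← map_smul, mk_map_mkQ_eq_zero_iff] at ha
    exact ha

variable [IsLocalRing A] [IsNoetherianRing A]

/-- Countable prime avoidance provides phantom nonzerodivisors over a complete local ring. -/
theorem hasCommonPhantomNonzerodivisors_of_isAdicComplete [Module.Finite A M]
    [IsAdicComplete (IsLocalRing.maximalIdeal A) A] :
    HasCommonPhantomNonzerodivisors (A := A) p M := by
  intro I J h
  let Ass : Ideal A → Set (Ideal A) := fun K => ⋃ e : ℕ, associatedPrimes A
    (ReducedFrobeniusPower A p (M ⧸ (K • ⊤ : Submodule A M)) e)
  have hcount : ∀ K, (Ass K).Countable := fun K =>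
    Set.countable_iUnion fun e => (associatedPrimes.finite A _).countable
  have hmem : ∀ {K P}, P ∈ Ass K → ∃ e, P ∈ associatedPrimes A
      (ReducedFrobeniusPower A p (M ⧸ (K • ⊤ : Submodule A M)) e) := Set.mem_iUnion.1
  have hmax : ∀ K ∈ ({I, J} : Set (Ideal A)), IsLocalRing.maximalIdeal A ∉ Ass K := by
    intro K hK hKmem
    obtain ⟨e, he⟩ := hmem hKmem
    obtain ⟨u, hu, hmu⟩ := exists_notMem_of_mem_associatedPrimes p he
    exact hu (h K hK e u hmu)
  obtain ⟨z, hzm, hz⟩ := IsLocalRing.exists_mem_maximalIdeal_forall_notMem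
    (Ps := Ass I ∪ Ass J) ((hcount I).union (hcount J))
    (by
      rintro P (hP | hP)
      all_goals
        obtain ⟨e, he⟩ := hmem hP
        exact he.isPrime)
    (by
      rintro (hP | hP)
      · exact hmax I (by simp) hP
      · exact hmax J (by simp) hP)
  exact ⟨z, hzm,
    isPhantomNonzerodivisor_of_notMem_associatedPrimes p fun e P hP =>
      hz P (Or.inl (Set.mem_iUnion.2 ⟨e, hP⟩)),
    isPhantomNonzerodivisor_of_notMem_associatedPrimes p fun e P hP =>
      hz P (Or.inr (Set.mem_iUnion.2 ⟨e, hP⟩))⟩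

/-- Under avoidance for `M`, either the maximal ideal contains a phantom nonzerodivisor modulo `I`,
or it annihilates a nonzero element of one of the modules `G^e(M / IM)`. -/
theorem SatisfiesAvoidance.exists_isPhantomNonzerodivisor (hM : SatisfiesAvoidance A p M)
    {I : Ideal A}
    (h : ∀ (e : ℕ) (u : FrobeniusPower A p e M),
      (∀ a ∈ IsLocalRing.maximalIdeal A, a • u ∈ I.frobeniusTightClosure p M e) →
        u ∈ I.frobeniusTightClosure p M e) :
    ∃ x ∈ IsLocalRing.maximalIdeal A, IsPhantomNonzerodivisor p M I x := by
  by_contra! hcon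
  obtain ⟨e, P, hP, hle⟩ := hM (I • ⊤) (IsLocalRing.maximalIdeal A) fun x hx => by
    by_contra hnot
    refine hcon x hx (isPhantomNonzerodivisor_of_notMem_associatedPrimes p fun e P hP hxP => ?_)
    exact hnot (Set.mem_iUnion.2 ⟨e, Set.mem_iUnion₂.2 ⟨P, hP, hxP⟩⟩)
  obtain ⟨u, hu, hPu⟩ := exists_notMem_of_mem_associatedPrimes p hP
  exact hu (h e u fun a ha => hPu a (hle ha))

end AssociatedPrimes

/-! ### Flat base change -/

section BaseChange

variable {R S : Type u} [CommRing R] [CommRing S] [Algebra R S] (p : ℕ) [Fact p.Prime]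
  [CharP R p] [CharP S p] {M M' : Type u} [AddCommGroup M] [Module R M] [AddCommGroup M']
  [Module S M'] (ε : S ⊗[R] M ≃ₗ[S] M')

/-- The canonical map `F^e_R(M) → F^e_S(M')` for `M' = S ⊗ M`. -/
noncomputable def FrobeniusPower.toBaseChange (e : ℕ) :
    FrobeniusPower R p e M →ₛₗ[algebraMap R S] FrobeniusPower S p e M' :=
  FrobeniusPower.lift p (algebraMap R S)
    ((frobeniusElementHom S p e).comp
      (ε.toLinearMap.toAddMonoidHom.comp (TensorProduct.mk R S M 1).toAddMonoidHom))
    (fun r z => by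
      change frobeniusElement S p e (ε (1 ⊗ₜ (r • z)))
        = algebraMap R S r ^ p ^ e • frobeniusElement S p e (ε (1 ⊗ₜ z))
      rw [← frobeniusElement_smul, ← map_smul, TensorProduct.tmul_smul, algebraMap_smul])

theorem FrobeniusPower.toBaseChange_frobeniusElement (e : ℕ) (z : M) :
    FrobeniusPower.toBaseChange p ε e (frobeniusElement R p e z)
      = frobeniusElement S p e (ε (1 ⊗ₜ z)) :=
  FrobeniusPower.lift_frobeniusElement p (algebraMap R S) _ _ z

theorem FrobeniusPower.toBaseChange_smul (e : ℕ) (r : R) (u : FrobeniusPower R p e M) :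
    FrobeniusPower.toBaseChange p ε e (r • u)
      = algebraMap R S r • FrobeniusPower.toBaseChange p ε e u :=
  LinearMap.map_smulₛₗ _ r u

theorem FrobeniusPower.toBaseChange_frob {e f : ℕ} (h : e ≤ f) (u : FrobeniusPower R p e M) :
    FrobeniusPower.toBaseChange p ε f (FrobeniusPower.frob p h u)
      = FrobeniusPower.frob p h (FrobeniusPower.toBaseChange p ε e u) := by
  induction u using FrobeniusPower.induction with
  | elem z => simp [toBaseChange_frobeniusElement]
  | zero => simp
  | add u v hu hv => simp only [map_add, hu, hv]
  | smul r u hu =>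
    rw [frob_smul, toBaseChange_smul, toBaseChange_smul, frob_smul, hu, map_pow]

variable (S M) in
/-- The additive map `s ⊗ z ↦ s ^ p ^ e ⊗ z ^ p ^ e` from `S ⊗ M` to `S ⊗ F^e(M)`. -/
noncomputable def tensorFrobeniusElementHom (e : ℕ) :
    S ⊗[R] M →+ S ⊗[R] FrobeniusPower R p e M :=
  TensorProduct.liftAddHom
    (AddMonoidHom.mk' (fun s => ((TensorProduct.mk R S (FrobeniusPower R p e M)
        (s ^ p ^ e)).toAddMonoidHom).comp (frobeniusElementHom R p e))
      (fun s t => by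
        ext z
        change ((s + t) ^ p ^ e) ⊗ₜ[R] frobeniusElement R p e z
          = (s ^ p ^ e) ⊗ₜ[R] frobeniusElement R p e z + (t ^ p ^ e) ⊗ₜ[R] frobeniusElement R p e z
        rw [add_pow_char_pow, TensorProduct.add_tmul]))
    (fun r s z => by
      change ((r • s) ^ p ^ e) ⊗ₜ[R] frobeniusElement R p e z
        = (s ^ p ^ e) ⊗ₜ[R] frobeniusElement R p e (r • z)
      rw [smul_pow, frobeniusElement_smul, TensorProduct.smul_tmul])

theorem tensorFrobeniusElementHom_tmul (e : ℕ) (s : S) (z : M) :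
    tensorFrobeniusElementHom S p M e (s ⊗ₜ[R] z) = (s ^ p ^ e) ⊗ₜ frobeniusElement R p e z := rfl

theorem tensorFrobeniusElementHom_smul (e : ℕ) (s : S) (z : S ⊗[R] M) :
    tensorFrobeniusElementHom S p M e (s • z)
      = s ^ p ^ e • tensorFrobeniusElementHom S p M e z := by
  induction z with
  | zero => simp
  | add x y hx hy => rw [smul_add, map_add, map_add, hx, hy, smul_add]
  | tmul t z =>
    rw [TensorProduct.smul_tmul', tensorFrobeniusElementHom_tmul, tensorFrobeniusElementHom_tmul,
      TensorProduct.smul_tmul', smul_eq_mul, smul_eq_mul, mul_pow]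

/-- The map `F^e_S(M') → S ⊗ F^e_R(M)` for `M' = S ⊗ M`. -/
noncomputable def FrobeniusPower.ofBaseChange (e : ℕ) :
    FrobeniusPower S p e M' →ₗ[S] S ⊗[R] FrobeniusPower R p e M :=
  FrobeniusPower.lift p (RingHom.id S)
    ((tensorFrobeniusElementHom S p M e).comp ε.symm.toLinearMap.toAddMonoidHom)
    (fun s z => by
      change tensorFrobeniusElementHom S p M e (ε.symm (s • z))
        = s ^ p ^ e • tensorFrobeniusElementHom S p M e (ε.symm z)
      rw [map_smul, tensorFrobeniusElementHom_smul])

theorem FrobeniusPower.ofBaseChange_frobeniusElement (e : ℕ) (z : S ⊗[R] M) :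
    FrobeniusPower.ofBaseChange p ε e (frobeniusElement S p e (ε z))
      = tensorFrobeniusElementHom S p M e z := by
  refine (FrobeniusPower.lift_frobeniusElement p (RingHom.id S) _ _ _).trans ?_
  change tensorFrobeniusElementHom S p M e (ε.symm (ε z)) = _
  rw [ε.symm_apply_apply]

theorem FrobeniusPower.ofBaseChange_toBaseChange (e : ℕ) (u : FrobeniusPower R p e M) :
    FrobeniusPower.ofBaseChange p ε e (FrobeniusPower.toBaseChange p ε e u) = 1 ⊗ₜ u := by
  induction u using FrobeniusPower.induction with
  | elem z => rw [toBaseChange_frobeniusElement, ofBaseChange_frobeniusElement,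
    tensorFrobeniusElementHom_tmul, one_pow]
  | zero => simp
  | add u v hu hv => rw [map_add, map_add, hu, hv, TensorProduct.tmul_add]
  | smul r u hu =>
    rw [toBaseChange_smul, map_smul, hu, TensorProduct.tmul_smul, algebraMap_smul]

/-- `F^e_S(M')` is spanned over `S` by the image of `F^e_R(M)`, in the following precise form:
an element of `F^e_S(M')` corresponding to an element of the image of `S ⊗ K`, for a submodule `K`
of `F^e_R(M)`, lies in the span of the image of `K`. -/
theorem FrobeniusPower.mem_span_toBaseChange (e : ℕ) (K : Submodule R (FrobeniusPower R p e M))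
    {u : FrobeniusPower S p e M'}
    (hu : FrobeniusPower.ofBaseChange p ε e u ∈ LinearMap.range (K.subtype.lTensor S)) :
    u ∈ Submodule.span S (FrobeniusPower.toBaseChange p ε e '' K) := by
  let _ : Module R (FrobeniusPower S p e M') := Module.compHom _ (algebraMap R S)
  have : IsScalarTower R S (FrobeniusPower S p e M') :=
    ⟨fun r s v => by rw [Algebra.smul_def, mul_smul]; rfl⟩
  let j : FrobeniusPower R p e M →ₗ[R] FrobeniusPower S p e M' :=
    { FrobeniusPower.toBaseChange p ε e with map_smul' := toBaseChange_smul p ε e }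
  let β : S ⊗[R] FrobeniusPower R p e M →ₗ[S] FrobeniusPower S p e M' := j.liftBaseChange S
  have hβ : ∀ s v, β (s ⊗ₜ v) = s • FrobeniusPower.toBaseChange p ε e v :=
    fun s v => LinearMap.liftBaseChange_tmul _ _ _ _
  have hβθ : ∀ w, β (FrobeniusPower.ofBaseChange p ε e w) = w := by
    intro w
    induction w using FrobeniusPower.induction with
    | elem z =>
      obtain ⟨z, rfl⟩ := ε.surjective z
      rw [ofBaseChange_frobeniusElement]
      induction z with
      | zero => simp [frobeniusElement_zero]
      | add x y hx hy => rw [map_add, map_add, map_add, hx, hy, frobeniusElement_add]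
      | tmul s z =>
        rw [tensorFrobeniusElementHom_tmul, hβ, toBaseChange_frobeniusElement,
          ← frobeniusElement_smul, ← map_smul, TensorProduct.smul_tmul', smul_eq_mul, mul_one]
    | zero => simp
    | add u v hu hv => rw [map_add, map_add, hu, hv]
    | smul r u hu => rw [map_smul, map_smul, hu]
  obtain ⟨t, ht⟩ := hu
  rw [← hβθ u, ← ht]
  clear ht
  induction t with
  | zero => simp
  | add x y hx hy => rw [map_add, map_add]; exact add_mem hx hy
  | tmul s k =>
    rw [LinearMap.lTensor_tmul, hβ]
    exact Submodule.smul_mem _ _ (Submodule.subset_span ⟨_, k.2, rfl⟩)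

/-- The extension of `I` kills `S ⊗ (L / IL)`. -/
theorem lTensor_mkQ_eq_zero_of_mem_map_smul_top {L : Type u} [AddCommGroup L] [Module R L]
    (I : Ideal R) {t : S ⊗[R] L}
    (ht : t ∈ (I.map (algebraMap R S) • ⊤ : Submodule S (S ⊗[R] L))) :
    (I • ⊤ : Submodule R L).mkQ.lTensor S t = 0 := by
  refine (Submodule.smul_le
    (P := LinearMap.ker ((I • ⊤ : Submodule R L).mkQ.baseChange S))).2 ?_ ht
  intro s hs n _
  rw [LinearMap.mem_ker, map_smul]
  generalize (I • ⊤ : Submodule R L).mkQ.baseChange S n = v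
  induction hs using Submodule.span_induction with
  | mem x hx =>
    obtain ⟨r, hr, rfl⟩ := hx
    rw [algebraMap_smul]
    induction v with
    | zero => simp
    | add x y hx hy => rw [smul_add, hx, hy, add_zero]
    | tmul s z =>
      obtain ⟨z, rfl⟩ := Submodule.Quotient.mk_surjective _ z
      rw [← TensorProduct.tmul_smul, ← Submodule.Quotient.mk_smul,
        (Submodule.Quotient.mk_eq_zero _).2 (Submodule.smul_mem_smul hr Submodule.mem_top),
        TensorProduct.tmul_zero]
  | zero => exact zero_smul _ _
  | add x y _ _ hx hy => rw [add_smul, hx, hy, add_zero]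
  | smul a x _ hx => rw [smul_eq_mul, mul_smul, hx, smul_zero]

theorem map_iterateFrobenius_map_algebraMap (I : Ideal R) (e : ℕ) :
    (I.map (algebraMap R S)).map (iterateFrobenius S p e)
      = (I.map (iterateFrobenius R p e)).map (algebraMap R S) := by
  rw [Ideal.map_map, Ideal.map_map]
  congr 1
  ext r
  simp [iterateFrobenius_def]

theorem FrobeniusPower.ofBaseChange_mem {I : Ideal R} {e : ℕ} {u : FrobeniusPower S p e M'}
    (hu : u ∈ (I.map (algebraMap R S)).frobeniusMul p M' e) :
    FrobeniusPower.ofBaseChange p ε e u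
      ∈ ((I.map (iterateFrobenius R p e)).map (algebraMap R S) • ⊤ :
        Submodule S (S ⊗[R] FrobeniusPower R p e M)) := by
  rw [Ideal.frobeniusMul, map_iterateFrobenius_map_algebraMap] at hu
  have := Submodule.mem_map_of_mem (f := FrobeniusPower.ofBaseChange p ε e) hu
  rw [Submodule.map_smul''] at this
  exact Submodule.smul_mono le_rfl le_top this

theorem FrobeniusPower.toBaseChange_mem {I : Ideal R} {e : ℕ} {u : FrobeniusPower R p e M}
    (hu : u ∈ I.frobeniusMul p M e) :
    FrobeniusPower.toBaseChange p ε e u ∈ (I.map (algebraMap R S)).frobeniusMul p M' e := by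
  rw [Ideal.frobeniusMul, map_iterateFrobenius_map_algebraMap]
  refine Submodule.smul_induction_on hu (fun r hr v _ => ?_) (fun v w hv hw => ?_)
  · rw [toBaseChange_smul]
    exact Submodule.smul_mem_smul (Ideal.mem_map_of_mem _ hr) Submodule.mem_top
  · rw [map_add]
    exact add_mem hv hw

theorem FrobeniusPower.mem_of_toBaseChange_mem [Module.FaithfullyFlat R S] {I : Ideal R} {e : ℕ}
    {u : FrobeniusPower R p e M}
    (hu : FrobeniusPower.toBaseChange p ε e u ∈ (I.map (algebraMap R S)).frobeniusMul p M' e) :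
    u ∈ I.frobeniusMul p M e := by
  have h := lTensor_mkQ_eq_zero_of_mem_map_smul_top _ (ofBaseChange_mem p ε hu)
  rw [ofBaseChange_toBaseChange, LinearMap.lTensor_tmul,
    Module.FaithfullyFlat.one_tmul_eq_zero_iff] at h
  exact (Submodule.Quotient.mk_eq_zero _).1 h

/-- Flatness: colons commute with base change. -/
theorem FrobeniusPower.mem_span_of_smul_mem [Module.Flat R S] {I : Ideal R} {e : ℕ} (r : R)
    {u : FrobeniusPower S p e M'}
    (hu : algebraMap R S r • u ∈ (I.map (algebraMap R S)).frobeniusMul p M' e) :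
    u ∈ Submodule.span S (FrobeniusPower.toBaseChange p ε e ''
      {k | r • k ∈ I.frobeniusMul p M e}) := by
  let T : FrobeniusPower R p e M →ₗ[R] FrobeniusPower R p e M ⧸ I.frobeniusMul p M e :=
    r • (I.frobeniusMul p M e).mkQ
  have h := lTensor_mkQ_eq_zero_of_mem_map_smul_top _ (ofBaseChange_mem p ε hu)
  have hT : T.lTensor S (FrobeniusPower.ofBaseChange p ε e u) = 0 := by
    rw [map_smul, algebraMap_smul, map_smul] at h
    rw [LinearMap.lTensor_smul]
    exact h
  have hex := Module.Flat.lTensor_exact S (LinearMap.exact_subtype_ker_map T)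
  have := mem_span_toBaseChange p ε e (LinearMap.ker T) (u := u) ((hex _).1 hT)
  convert this using 3
  ext k
  simp only [Set.mem_ofPred_eq, SetLike.mem_coe, LinearMap.mem_ker, T, LinearMap.smul_apply]
  rw [← map_smul]
  exact (Submodule.Quotient.mk_eq_zero _).symm

variable {p} {e₀ : ℕ} {c : R} [Module.Finite R M] [Module.Finite S M']

theorem FrobeniusPower.toBaseChange_mem_frobeniusTightClosure (hc : IsWeakTestElement R p e₀ c)
    (hcS : IsWeakTestElement S p e₀ (algebraMap R S c)) {I : Ideal R} {e : ℕ}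
    {u : FrobeniusPower R p e M} (hu : u ∈ I.frobeniusTightClosure p M e) :
    FrobeniusPower.toBaseChange p ε e u
      ∈ (I.map (algebraMap R S)).frobeniusTightClosure p M' e := by
  rw [hcS.mem_frobeniusTightClosure_iff]
  intro f h hf
  rw [← toBaseChange_frob, ← toBaseChange_smul]
  exact toBaseChange_mem p ε (hc.mem_frobeniusTightClosure_iff.1 hu f h hf)

theorem FrobeniusPower.mem_frobeniusTightClosure_of_toBaseChange_mem [Module.FaithfullyFlat R S]
    (hc : IsWeakTestElement R p e₀ c) (hcS : IsWeakTestElement S p e₀ (algebraMap R S c))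
    {I : Ideal R} {e : ℕ} {u : FrobeniusPower R p e M}
    (hu : FrobeniusPower.toBaseChange p ε e u
      ∈ (I.map (algebraMap R S)).frobeniusTightClosure p M' e) :
    u ∈ I.frobeniusTightClosure p M e := by
  rw [hc.mem_frobeniusTightClosure_iff]
  intro f h hf
  have := hcS.mem_frobeniusTightClosure_iff.1 hu f h hf
  rw [← toBaseChange_frob, ← toBaseChange_smul] at this
  exact mem_of_toBaseChange_mem p ε this

theorem IsPhantomNonzerodivisor.map_algebraMap [Module.Flat R S] (ε : S ⊗[R] M ≃ₗ[S] M')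
    (hc : IsWeakTestElement R p e₀ c) (hcS : IsWeakTestElement S p e₀ (algebraMap R S c))
    {I : Ideal R} {x : R} (hx : IsPhantomNonzerodivisor p M I x) :
    IsPhantomNonzerodivisor p M' (I.map (algebraMap R S)) (algebraMap R S x) := by
  intro e u hu
  rw [← map_pow] at hu
  refine Submodule.span_le.2 ?_ (FrobeniusPower.mem_span_of_smul_mem p ε _ hu)
  rintro _ ⟨k, hk, rfl⟩
  exact FrobeniusPower.toBaseChange_mem_frobeniusTightClosure ε hc hcS (hx e k hk)

variable [IsLocalRing R] [IsLocalRing S]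

theorem HasPhantomSequence.map_algebraMap [Module.Flat R S] (ε : S ⊗[R] M ≃ₗ[S] M')
    (hmS : IsLocalRing.maximalIdeal S = (IsLocalRing.maximalIdeal R).map (algebraMap R S))
    (hc : IsWeakTestElement R p e₀ c) (hcS : IsWeakTestElement S p e₀ (algebraMap R S c))
    {n : ℕ} {I : Ideal R} (h : HasPhantomSequence p M n I) :
    HasPhantomSequence p M' n (I.map (algebraMap R S)) := by
  induction n generalizing I with
  | zero => trivial
  | succ n ih =>
    obtain ⟨x, hxm, hx, hn⟩ := h
    refine ⟨algebraMap R S x, ?_, hx.map_algebraMap ε hc hcS, ?_⟩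
    · exact hmS ▸ Ideal.mem_map_of_mem _ hxm
    · have := ih hn
      rwa [Ideal.map_sup, Ideal.map_span, Set.image_singleton] at this

/-- Phantom sequences descend along `R → S`: avoidance for `M` yields a phantom nonzerodivisor in
`R`, and over `S` it may be exchanged for the first member of a given sequence. -/
theorem HasPhantomSequence.of_map_algebraMap [IsNoetherianRing R] [Module.FaithfullyFlat R S]
    (ε : S ⊗[R] M ≃ₗ[S] M')
    (hmS : IsLocalRing.maximalIdeal S = (IsLocalRing.maximalIdeal R).map (algebraMap R S))
    (hc : IsWeakTestElement R p e₀ c) (hcS : IsWeakTestElement S p e₀ (algebraMap R S c))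
    (hM : SatisfiesAvoidance R p M) (hS : HasCommonPhantomNonzerodivisors (A := S) p M')
    {n : ℕ} {I : Ideal R} (h : HasPhantomSequence p M' n (I.map (algebraMap R S))) :
    HasPhantomSequence p M n I := by
  induction n generalizing I with
  | zero => trivial
  | succ n ih =>
    obtain ⟨y, hym, hy, -⟩ := id h
    obtain ⟨x, hxm, hx⟩ := hM.exists_isPhantomNonzerodivisor p (I := I) (by
      intro e u hu
      refine FrobeniusPower.mem_frobeniusTightClosure_of_toBaseChange_mem ε hc hcS
        (hy.mem_of_smul_mem hcS ?_)
      rw [hmS] at hym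
      clear hy
      induction hym using Submodule.span_induction with
      | mem a ha =>
        obtain ⟨a, ha, rfl⟩ := ha
        rw [← FrobeniusPower.toBaseChange_smul]
        exact FrobeniusPower.toBaseChange_mem_frobeniusTightClosure ε hc hcS (hu a ha)
      | zero => rw [zero_smul]; exact zero_mem _
      | add a b _ _ ha hb => rw [add_smul]; exact add_mem ha hb
      | smul s a _ ha => rw [smul_eq_mul, mul_smul]; exact Submodule.smul_mem _ _ ha)
    refine ⟨x, hxm, hx, ih ?_⟩
    have hxS : algebraMap R S x ∈ IsLocalRing.maximalIdeal S :=
      hmS ▸ Ideal.mem_map_of_mem _ hxm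
    have := h.exchange hcS hS hxS (hx.map_algebraMap ε hc hcS)
    rwa [Ideal.map_sup, Ideal.map_span, Set.image_singleton]

end BaseChange

/-! ### Phantom regular sequences and phantom depth -/

section PhantomDepthComparison

variable {A : Type u} [CommRing A] (p : ℕ) [Fact p.Prime] [CharP A p]
  {M : Type u} [AddCommGroup M] [Module A M]

theorem isPhantomRegular_quotient_iff {I : Ideal A} {x : A} :
    IsPhantomRegular p (M ⧸ (I • ⊤ : Submodule A M)) x ↔
      Ideal.span {x} • (⊤ : Submodule A (M ⧸ (I • ⊤ : Submodule A M))) ≠ ⊤ ∧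
        IsPhantomNonzerodivisor p M I x := by
  refine and_congr_right fun _ => forall_congr' fun e => ?_
  rw [(FrobeniusPower.map_surjective p e
    (Submodule.mkQ_surjective (I • ⊤ : Submodule A M))).forall]
  refine forall_congr' fun u => ?_
  rw [← map_smul, FrobeniusPower.map_mkQ_eq_zero_iff]
  rfl

variable [IsLocalRing A]

theorem IsLocalRing.smul_top_ne_top [Module.Finite A M] [Nontrivial M] {I : Ideal A}
    (hI : I ≤ IsLocalRing.maximalIdeal A) : I • (⊤ : Submodule A M) ≠ ⊤ := fun h =>
  top_ne_bot (α := Submodule A M) (Submodule.eq_bot_of_le_smul_of_le_jacobson_bot I ⊤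
    Module.Finite.fg_top h.ge (hI.trans (IsLocalRing.maximalIdeal_le_jacobson ⊥)))

theorem isPhantomRegularSequence_iff [Module.Finite A M] {xs : List A}
    (hxs : ∀ x ∈ xs, x ∈ IsLocalRing.maximalIdeal A) :
    IsPhantomRegularSequence p M xs ↔ Nontrivial M ∧ ∀ (i : ℕ) (hi : i < xs.length),
      IsPhantomNonzerodivisor p M (Ideal.ofList (xs.take i)) xs[i] := by
  constructor
  · rintro ⟨hne, h⟩
    refine ⟨?_, fun i hi => ((isPhantomRegular_quotient_iff p).1 (h i hi)).2⟩
    by_contra hM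
    rw [not_nontrivial_iff_subsingleton] at hM
    exact hne (Subsingleton.elim _ _)
  · rintro ⟨hM, h⟩
    have hle : ∀ ys : List A, (∀ y ∈ ys, y ∈ xs) → Ideal.ofList ys ≤ IsLocalRing.maximalIdeal A :=
      fun ys hys => Ideal.span_le.2 fun y hy => hxs y (hys y hy)
    refine ⟨IsLocalRing.smul_top_ne_top (hle xs fun _ h => h), fun i hi =>
      (isPhantomRegular_quotient_iff p).2 ⟨?_, h i hi⟩⟩
    have : Nontrivial (M ⧸ (Ideal.ofList (xs.take i) • ⊤ : Submodule A M)) :=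
      Submodule.Quotient.nontrivial_iff.2
        (IsLocalRing.smul_top_ne_top (hle _ fun _ h => List.mem_of_mem_take h))
    refine IsLocalRing.smul_top_ne_top ((Ideal.span_singleton_le_iff_mem _).2 (hxs _ ?_))
    exact List.getElem_mem hi

theorem hasPhantomSequence_iff {n : ℕ} {I : Ideal A} :
    HasPhantomSequence p M n I ↔ ∃ xs : List A, (∀ x ∈ xs, x ∈ IsLocalRing.maximalIdeal A) ∧
      xs.length = n ∧ ∀ (i : ℕ) (hi : i < xs.length),
        IsPhantomNonzerodivisor p M (I ⊔ Ideal.ofList (xs.take i)) xs[i] := by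
  induction n generalizing I with
  | zero =>
    exact ⟨fun _ => ⟨[], by simp, rfl, fun i hi => absurd hi (by simp)⟩, fun _ => trivial⟩
  | succ n ih =>
    constructor
    · rintro ⟨x, hxm, hx, h⟩
      obtain ⟨xs, hxs, hlen, h⟩ := ih.1 h
      refine ⟨x :: xs, by simpa using ⟨hxm, hxs⟩, by simp [hlen], fun i hi => ?_⟩
      cases i with
      | zero => simpa using hx
      | succ i =>
        have := h i (by simpa using hi)
        rwa [sup_assoc, ← Ideal.ofList_cons] at this
    · rintro ⟨xs, hxs, hlen, h⟩
      cases xs with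
      | nil => simp at hlen
      | cons x xs =>
        have h0 : IsPhantomNonzerodivisor p M (I ⊔ Ideal.ofList []) x := h 0 (by simp)
        refine ⟨x, hxs x (by simp), by simpa using h0, ih.2
          ⟨xs, fun y hy => hxs y (by simp [hy]), by simpa using hlen, fun i hi => ?_⟩⟩
        have := h (i + 1) (by simpa using hi)
        rwa [List.take_succ_cons, Ideal.ofList_cons, ← sup_assoc] at this

theorem exists_isPhantomRegularSequence_iff [Module.Finite A M] {n : ℕ} :
    (∃ xs : List A, (∀ x ∈ xs, x ∈ IsLocalRing.maximalIdeal A) ∧ xs.length = n ∧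
      IsPhantomRegularSequence p M xs) ↔ Nontrivial M ∧ HasPhantomSequence p M n (⊥ : Ideal A) := by
  rw [hasPhantomSequence_iff]
  simp only [bot_sup_eq]
  constructor
  · rintro ⟨xs, hxs, hn, h⟩
    rw [isPhantomRegularSequence_iff p hxs] at h
    exact ⟨h.1, xs, hxs, hn, h.2⟩
  · rintro ⟨hM, xs, hxs, hn, h⟩
    exact ⟨xs, hxs, hn, (isPhantomRegularSequence_iff p hxs).2 ⟨hM, h⟩⟩

theorem phantomDepth_le [Module.Finite A M] {B : Type u} [CommRing B] [CharP B p] [IsLocalRing B]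
    {N : Type u} [AddCommGroup N] [Module B N] [Module.Finite B N]
    (hMN : Nontrivial M → Nontrivial N)
    (h : ∀ n, HasPhantomSequence p M n (⊥ : Ideal A) →
      HasPhantomSequence p N n (⊥ : Ideal B)) :
    phantomDepth A p M ≤ phantomDepth B p N := by
  refine iSup_le fun xs => iSup_le fun hxs => iSup_le fun hreg => ?_
  obtain ⟨hM, hseq⟩ := (exists_isPhantomRegularSequence_iff p).1 ⟨xs, hxs, rfl, hreg⟩
  obtain ⟨ys, hys, hlen, hreg'⟩ :=
    (exists_isPhantomRegularSequence_iff p).2 ⟨hMN hM, h _ hseq⟩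
  rw [← hlen]
  exact le_iSup_of_le ys (le_iSup_of_le hys (le_iSup_of_le hreg' le_rfl))

end PhantomDepthComparison

theorem mainTheorem2 (R : Type u) [CommRing R] [IsNoetherianRing R] [IsLocalRing R]
    (p : ℕ) [Fact p.Prime] [CharP R p]
    (hR : ∃ (e₀ : ℕ) (c : R), IsCompletelyStableWeakTestElement R p e₀ c)
    (M : Type u) [AddCommGroup M] [Module R M] [Module.Finite R M]
    (hM : SatisfiesAvoidance R p M) :
    phantomDepth R p M =
      phantomDepth (AdicCompletion (IsLocalRing.maximalIdeal R) R) p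
        (AdicCompletion (IsLocalRing.maximalIdeal R) M) := by
  obtain ⟨e₀, c, hc, hcS, -⟩ := hR
  let ε := AdicCompletion.ofTensorProductEquivOfFiniteNoetherian (IsLocalRing.maximalIdeal R) M
  have : Module.Finite (AdicCompletion (IsLocalRing.maximalIdeal R) R)
      (AdicCompletion (IsLocalRing.maximalIdeal R) M) := Module.Finite.equiv ε
  have : IsNoetherianRing (AdicCompletion (IsLocalRing.maximalIdeal R) R) :=
    AdicCompletion.isNoetherianRing _
  have : Module.FaithfullyFlat R (AdicCompletion (IsLocalRing.maximalIdeal R) R) :=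
    Module.FaithfullyFlat.of_flat_of_isLocalHom
  have hmS := AdicCompletion.maximalIdeal_eq_map (R := R)
  have hnontriv : Nontrivial M ↔ Nontrivial (AdicCompletion (IsLocalRing.maximalIdeal R) M) :=
    (Module.FaithfullyFlat.nontrivial_tensorProduct_iff_right R
      (AdicCompletion (IsLocalRing.maximalIdeal R) R)).symm.trans ε.toEquiv.nontrivial_congr
  refine le_antisymm (phantomDepth_le p hnontriv.1 fun n h => ?_)
    (phantomDepth_le p hnontriv.2 fun n h => ?_)
  · simpa using h.map_algebraMap ε hmS hc hcS
  · refine HasPhantomSequence.of_map_algebraMap ε hmS hc hcS hM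
      (hasCommonPhantomNonzerodivisors_of_isAdicComplete p) ?_
    simpa using h
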